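/- Let $\mathcal M$ be a von Neumann algebra acting on a complex Hilbert space $H$, equipped with a faithful normal semifinite trace $\tau$, and let $L_0(\mathcal M,\tau)$ be the $*$-algebra of $\tau$-measurable operators (closed densely defined operators $x$ affiliated with $\mathcal M$ with $\tau(\chi_{(s,\infty)}(|x|))<\infty$ for some $s>0$), in which products and sums are the closures of the operator product and operator sum. For $x\in L_0(\mathcal M,\tau)$ and $t>0$ put $\mu_t(x)=\inf\{s>0:\tau(\chi_{(s,\infty)}(|x|))\le t\}$. An Orlicz function is a continuous, nondecreasing, convex function $\Phi:[0,\infty)\to[0,\infty)$ with $\Phi(0)=0$ and $\lim_{t\to\infty}\Phi(t)=\infty$. Put $M(t,\Phi)=\sup_{s>0}\Phi(ts)/\Phi(s)$ and $$p_\Phi=\lim_{t\to0^+}\frac{\log M(t,\Phi)}{\log t},\qquad q_\Phi=\lim_{t\to\infty}\frac{\log M(t,\Phi)}{\log t}.$$ Let $\phi$ be the right derivative of $\Phi$, let $\psi(t)=\sup\{s\ge 0:\phi(s)\le t\}$, and let $\Phi^*(v)=\int_0^v\psi(t)\,dt$ be the complementary function. The space $L_\Phi(\mathcal M)$ consists of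 all $x\in L_0(\mathcal M,\tau)$ such that $\int_0^\infty\Phi(\mu_t(x)/c)\,dt<\infty$ for some $c>0$; $L_{\Phi^*}(\mathcal M)$ is defined in the same way from $\Phi^*$. Let $\Phi$ be an Orlicz function with $1<p_\Phi\le q_\Phi<\infty$. Then for every $0\le x\in L_\Phi(\mathcal M)$ there exists $0\le y\in L_{\Phi^*}(\mathcal M)$ which commutes with $x$ (that is, $xy=yx$ in $L_0(\mathcal M,\tau)$, and the spectral projections of $x$ and $y$ commute) and satisfies $$xy=\Phi(x)+\Phi^*(y),$$ where $\Phi(x)$ and $\Phi^*(y)$ are given by Borel functional calculus. Moreover, one can take $y=\phi(x)$. -/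

import Mathlib

open MeasureTheory Filter Topology
open scoped ENNReal NNReal

namespace OrliczYoung

noncomputable section

/-! ### Orlicz functions -/

/-- Orlicz functions on `[0, ∞)`; the values of `Φ` at negative reals play no role. -/
structure IsOrlicz (Φ : ℝ → ℝ) : Prop where
  continuousOn : ContinuousOn Φ (Set.Ici 0)
  monotoneOn : MonotoneOn Φ (Set.Ici 0)
  convexOn : ConvexOn ℝ (Set.Ici 0) Φ
  map_zero : Φ 0 = 0
  tendsto_atTop : Tendsto Φ atTop atTop

/-- `M(t, Φ) = sup_{s > 0} Φ(ts) / Φ(s)`, with values in `[0, ∞]`. -/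
def dilation (Φ : ℝ → ℝ) (t : ℝ) : ℝ≥0∞ :=
  ⨆ (s : ℝ) (_ : 0 < s), ENNReal.ofReal (Φ (t * s)) / ENNReal.ofReal (Φ s)

/-- `p` is the lower Matuszewska–Orlicz index `p_Φ = lim_{t → 0+} log M(t, Φ) / log t`. -/
def IsLowerIndex (Φ : ℝ → ℝ) (p : EReal) : Prop :=
  Tendsto (fun t : ℝ => ENNReal.log (dilation Φ t) / ((Real.log t : ℝ) : EReal))
    (𝓝[>] 0) (𝓝 p)

/-- `q` is the upper Matuszewska–Orlicz index `q_Φ = lim_{t → ∞} log M(t, Φ) / log t`. -/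
def IsUpperIndex (Φ : ℝ → ℝ) (q : EReal) : Prop :=
  Tendsto (fun t : ℝ => ENNReal.log (dilation Φ t) / ((Real.log t : ℝ) : EReal))
    atTop (𝓝 q)

/-- The right derivative `φ` of `Φ`. -/
def rightDeriv (Φ : ℝ → ℝ) (u : ℝ) : ℝ := derivWithin Φ (Set.Ioi u) u

/-- The right inverse `ψ(t) = sup {s ≥ 0 : φ(s) ≤ t}` of the right derivative of `Φ`. -/
def rightInv (Φ : ℝ → ℝ) (t : ℝ) : ℝ := sSup {s : ℝ | 0 ≤ s ∧ rightDeriv Φ s ≤ t}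

/-- The complementary function `Φ*(v) = ∫₀ᵛ ψ(t) dt`. -/
def complementary (Φ : ℝ → ℝ) (v : ℝ) : ℝ := ∫ t in (0 : ℝ)..v, rightInv Φ t

variable {H : Type*} [NormedAddCommGroup H] [InnerProductSpace ℂ H] [CompleteSpace H]

/-! ### Traces on von Neumann algebras -/

/-- `τ` restricts to a faithful normal semifinite trace on the positive cone `M₊` of the von Neumann
algebra `M`; the values of `τ` off `M₊` play no role. -/
structure IsFaithfulNormalSemifiniteTrace (M : VonNeumannAlgebra H)
    (τ : (H →L[ℂ] H) → ℝ≥0∞) : Prop where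
  map_add : ∀ a ∈ M, ∀ b ∈ M, 0 ≤ a → 0 ≤ b → τ (a + b) = τ a + τ b
  map_smul : ∀ a ∈ M, 0 ≤ a → ∀ c : ℝ≥0, τ (((c : ℝ) : ℂ) • a) = c * τ a
  tracial : ∀ a ∈ M, τ (star a * a) = τ (a * star a)
  faithful : ∀ a ∈ M, 0 ≤ a → τ a = 0 → a = 0
  normal : ∀ S : Set (H →L[ℂ] H), (∀ a ∈ S, a ∈ M ∧ 0 ≤ a) → S.Nonempty →
    DirectedOn (· ≤ ·) S → ∀ a ∈ M, IsLUB S a → τ a = ⨆ b ∈ S, τ b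
  semifinite : ∀ a ∈ M, 0 ≤ a → a ≠ 0 → ∃ b ∈ M, 0 ≤ b ∧ b ≤ a ∧ b ≠ 0 ∧ τ b < ⊤

/-! ### Spectral measures and Borel functional calculus of unbounded operators -/

variable (H) in
/-- Projection-valued (spectral) measures on the Borel sets of `ℝ`, countably additive in the strong
operator topology, with the value `0` assigned to sets that are not Borel. -/
structure SpectralMeasure where
  proj : Set ℝ → (H →L[ℂ] H)
  isStarProjection : ∀ B, MeasurableSet B → IsStarProjection (proj B)
  of_not_measurable : ∀ B, ¬ MeasurableSet B → proj B = 0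
  univ : proj Set.univ = 1
  inter : ∀ B C, MeasurableSet B → MeasurableSet C → proj (B ∩ C) = proj B * proj C
  hasSum : ∀ B : ℕ → Set ℝ, (∀ n, MeasurableSet (B n)) → Pairwise (Function.onFun Disjoint B) →
    ∀ ξ : H, HasSum (fun n => proj (B n) ξ) (proj (⋃ n, B n) ξ)

namespace SpectralMeasure

open Classical in
/-- The spectral measure of the zero operator, which serves as a default value. -/
instance : Inhabited (SpectralMeasure H) where
  default :=
    { proj := fun B => if MeasurableSet B ∧ (0 : ℝ) ∈ B then 1 else 0
      isStarProjection := by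
        intro B _
        split_ifs
        · exact .one _
        · exact .zero _
      of_not_measurable := by intro B hB; simp [hB]
      univ := by simp
      inter := by
        intro B C hB hC
        by_cases h1 : (0 : ℝ) ∈ B <;> by_cases h2 : (0 : ℝ) ∈ C <;> simp [hB, hC, hB.inter hC, h1, h2]
      hasSum := by
        intro B hB hd ξ
        have hU : MeasurableSet (⋃ n, B n) := MeasurableSet.iUnion hB
        by_cases h : ∃ n, (0 : ℝ) ∈ B n
        · obtain ⟨n, hn⟩ := h
          have key := hasSum_single (f := fun n =>
            (if MeasurableSet (B n) ∧ (0 : ℝ) ∈ B n then (1 : H →L[ℂ] H) else 0) ξ) n (by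
              intro m hm
              have : (0 : ℝ) ∉ B m := fun h0 => Set.disjoint_left.1 (hd hm) h0 hn
              simp [this])
          have h0 : (0 : ℝ) ∈ ⋃ n, B n := Set.mem_iUnion.2 ⟨n, hn⟩
          simpa [hB, hn, hU, h0] using key
        · have h0 : (0 : ℝ) ∉ ⋃ n, B n := fun h' => h (Set.mem_iUnion.1 h')
          push Not at h
          simp [h, h0] }

theorem inner_proj (E : SpectralMeasure H) {B : Set ℝ} (hB : MeasurableSet B) (ξ : H) :
    RCLike.re (inner ℂ ξ (E.proj B ξ)) = ‖E.proj B ξ‖ ^ 2 := by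
  have hp := E.isStarProjection B hB
  have h1 : E.proj B (E.proj B ξ) = E.proj B ξ :=
    congrArg (fun T : H →L[ℂ] H => T ξ) hp.isIdempotentElem
  have h2 : inner ℂ ξ (E.proj B (E.proj B ξ)) = inner ℂ (E.proj B ξ) (E.proj B ξ) := by
    rw [← ContinuousLinearMap.adjoint_inner_left, ← ContinuousLinearMap.star_eq_adjoint,
      hp.isSelfAdjoint.star_eq]
  rw [← h1, h2, h1, inner_self_eq_norm_sq]

/-- The measure `B ↦ ⟨ξ, E(B) ξ⟩ = ‖E(B) ξ‖²`. -/
def scalar (E : SpectralMeasure H) (ξ : H) : Measure ℝ :=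
  Measure.ofMeasurable (fun B _ => ENNReal.ofReal (‖E.proj B ξ‖ ^ 2))
    (by
      have h := (E.hasSum (fun _ => ∅) (fun _ => MeasurableSet.empty)
        (fun _ _ _ => disjoint_bot_left) ξ).summable
      simpa using (summable_const_iff _).1 h)
    (by
      intro B hB hd
      have hs : HasSum (fun n => ‖E.proj (B n) ξ‖ ^ 2) (‖E.proj (⋃ n, B n) ξ‖ ^ 2) := by
        have h1 := ((innerSL ℂ ξ).hasSum (E.hasSum B hB hd ξ)).mapL RCLike.reCLM
        have h2 : ∀ C, MeasurableSet C →
            RCLike.re (inner ℂ ξ (E.proj C ξ)) = ‖E.proj C ξ‖ ^ 2 := fun C hC => E.inner_proj hC ξ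
        simpa [h2 _ (hB _), h2 _ (MeasurableSet.iUnion hB)] using h1
      rw [← hs.tsum_eq, ENNReal.ofReal_tsum_of_nonneg (fun n => by positivity) hs.summable])

/-- `T = ∫ f dE`: the domain of `T` is `{ξ : ∫ |f|² d⟨ξ, E ξ⟩ < ∞}`, and
`⟨ξ, T ξ⟩ = ∫ f d⟨ξ, E ξ⟩` on it. By polarization there is at most one such `T`. -/
def IsIntegral (E : SpectralMeasure H) (f : ℝ → ℝ) (T : H →ₗ.[ℂ] H) : Prop :=
  (∀ ξ : H, ξ ∈ T.domain ↔ ∫⁻ s, ENNReal.ofReal (f s ^ 2) ∂(E.scalar ξ) < ⊤) ∧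
  ∀ ξ : T.domain, inner ℂ (ξ : H) (T ξ) = ((∫ s, f s ∂(E.scalar (ξ : H)) : ℝ) : ℂ)

open Classical in
/-- The operator `∫ f dE`. -/
def integral (E : SpectralMeasure H) (f : ℝ → ℝ) : H →ₗ.[ℂ] H :=
  if h : ∃ T, E.IsIntegral f T then h.choose else 0

end SpectralMeasure

open Classical in
/-- The spectral measure of a self-adjoint operator `A`: the projection-valued measure `E` with
`A = ∫ s dE(s)`. -/
def spectralMeasure (A : H →ₗ.[ℂ] H) : SpectralMeasure H :=
  if h : ∃ E : SpectralMeasure H, E.IsIntegral (fun s => s) A then h.choose else default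

/-- The spectral projection `χ_B(A)`. -/
def spectralProj (A : H →ₗ.[ℂ] H) (B : Set ℝ) : H →L[ℂ] H := (spectralMeasure A).proj B

/-- Functional calculus `f(A) = ∫_{[0, ∞)} f(s) dE(s)` of a positive self-adjoint operator `A`. -/
def posCalculus (A : H →ₗ.[ℂ] H) (f : ℝ → ℝ) : H →ₗ.[ℂ] H :=
  (spectralMeasure A).integral ((Set.Ici 0).indicator f)

/-! ### Measurable operators -/

/-- `A` is a positive self-adjoint operator (in particular closed and densely defined). -/
def IsPositiveSelfAdjoint (A : H →ₗ.[ℂ] H) : Prop :=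
  Dense (A.domain : Set H) ∧ IsSelfAdjoint A ∧
    ∀ ξ : A.domain, 0 ≤ RCLike.re (inner ℂ (ξ : H) (A ξ))

/-- `A` commutes with every unitary in the commutant of `M`. -/
def IsAffiliated (M : VonNeumannAlgebra H) (A : H →ₗ.[ℂ] H) : Prop :=
  ∀ u ∈ M.commutant, u ∈ unitary (H →L[ℂ] H) →
    ∀ ξ : A.domain, ∃ h : u ξ ∈ A.domain, A ⟨u ξ, h⟩ = u (A ξ)

/-- The distribution function `λ_s(A) = τ(χ_{(s, ∞)}(A))` of a positive operator (`|A| = A`). -/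
def distribution (τ : (H →L[ℂ] H) → ℝ≥0∞) (A : H →ₗ.[ℂ] H) (s : ℝ) : ℝ≥0∞ :=
  τ (spectralProj A (Set.Ioi s))

/-- `A` is a positive element of the space `L₀(M, τ)` of `τ`-measurable operators. -/
def IsPositiveMeasurable (M : VonNeumannAlgebra H) (τ : (H →L[ℂ] H) → ℝ≥0∞)
    (A : H →ₗ.[ℂ] H) : Prop :=
  IsPositiveSelfAdjoint A ∧ IsAffiliated M A ∧ ∃ s : ℝ, 0 < s ∧ distribution τ A s < ⊤

/-- The generalized singular value `μ_t(A) = inf {s > 0 : λ_s(A) ≤ t}`. -/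
def singularValue (τ : (H →L[ℂ] H) → ℝ≥0∞) (A : H →ₗ.[ℂ] H) (t : ℝ) : ℝ :=
  sInf {s : ℝ | 0 < s ∧ distribution τ A s ≤ ENNReal.ofReal t}

/-- Membership of a function in the Orlicz function space `L_Φ(0, ∞)`. -/
def MemOrlicz (Φ : ℝ → ℝ) (f : ℝ → ℝ) : Prop :=
  AEMeasurable f (volume.restrict (Set.Ioi 0)) ∧
    ∃ c : ℝ, 0 < c ∧ ∫⁻ t in Set.Ioi (0 : ℝ), ENNReal.ofReal (Φ (|f t| / c)) < ⊤

/-- `A` is a positive element of the noncommutative Orlicz space `L_Φ(M, τ)`: a positive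
`τ`-measurable operator whose singular value function lies in `L_Φ(0, ∞)`. -/
def MemOrliczPos (Φ : ℝ → ℝ) (M : VonNeumannAlgebra H) (τ : (H →L[ℂ] H) → ℝ≥0∞)
    (A : H →ₗ.[ℂ] H) : Prop :=
  IsPositiveMeasurable M τ A ∧ MemOrlicz Φ (singularValue τ A)

/-- The composition `AB` on its natural domain `{ξ ∈ dom B : B ξ ∈ dom A}`. -/
def naturalComp (A B : H →ₗ.[ℂ] H) : H →ₗ.[ℂ] H where
  domain := (A.domain.comap B.toFun).map B.domain.subtype
  toFun :=
    { toFun := fun ξ => A ⟨B ⟨ξ, by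
          obtain ⟨_, η, -, rfl⟩ := ξ; exact η.2⟩, by
          obtain ⟨_, η, hη, rfl⟩ := ξ; exact hη⟩
      map_add' := by
        intro ξ η
        rw [← LinearPMap.map_add]
        congr 1
        ext
        simp only [Submodule.coe_add]
        rw [← LinearPMap.map_add]
        rfl
      map_smul' := by
        intro c ξ
        rw [RingHom.id_apply, ← LinearPMap.map_smul]
        congr 1
        ext
        simp only [Submodule.coe_smul]
        rw [← LinearPMap.map_smul]
        rfl }

/-- The product in `L₀(M, τ)`: the closure of the composition. -/
def strongMul (A B : H →ₗ.[ℂ] H) : H →ₗ.[ℂ] H := (naturalComp A B).closure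

/-- The sum in `L₀(M, τ)`: the closure of the sum on the intersection of the domains. -/
def strongAdd (A B : H →ₗ.[ℂ] H) : H →ₗ.[ℂ] H := (A + B).closure

end

end OrliczYoung

/-! Everything happens inside the Borel calculus of the single operator x. Write x = ∫ s dE(s) and
put y = ∫ φ dE. Then xy, Φ(x) and Φ*(y) are all integrals against the same E, strong sums and
products become pointwise ones, and the claim reduces to Young's equality uφ(u) = Φ(u) + Φ*(φ(u))
for u ≥ 0 (`mul_rightDeriv_eq`). That equality splits the area of the rectangle [0,u] × [0,φ(u)]
along the graph of φ.

The indices enter twice. From p > 1 it follows that φ is unbounded, so ψ is a genuine finite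
supremum. From q < ∞ comes the Δ₂-condition. Since φ is monotone, μ_t(φ(x)) ≤ φ(s) for every s >
μ_t(x), and Φ*(φ(s)) ≤ Φ(2s) by convexity; letting s decrease to μ_t(x) and applying Δ₂ puts y in
L_{Φ*}.

The spectral theory rests on one abstract device, `Calculus`: an algebra of bounded functions, dense
in every L², acting by self-adjoint operators with scalar measures μ_ξ. The map f ↦ f(S)ξ extends
isometrically to L²(μ_ξ), and `pmap` collects these vectors into a self-adjoint operator. Applied to
continuous functions of R = (1 + A)⁻¹, it gives the existence of the spectral measure of a positive
A; applied to simple functions and a given E, it gives ∫ f dE. Uniqueness holds because A alone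
determines (1 + A)⁻¹, whose symbol separates points. Uniqueness in turn gives the composition rule
k(f(x)) = (k∘f)(x) and shows that the spectral projections of x lie in M. -/

namespace OrliczYoung

noncomputable section

/-! ### Square-integrable functions -/

section SquareIntegrable

variable {α : Type*} [MeasurableSpace α] {μ : Measure α}

theorem sq_eLpNorm_two (f : α → ℝ) (μ : Measure α) :
    eLpNorm f 2 μ ^ 2 = ∫⁻ a, ENNReal.ofReal (f a ^ 2) ∂μ := by
  have h := eLpNorm_nnreal_pow_eq_lintegral (μ := μ) (f := f) (p := 2) two_ne_zero
  have h2 : ((2 : ℝ≥0) : ℝ≥0∞) = 2 := rfl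
  have h3 : ((2 : ℝ≥0) : ℝ) = (2 : ℕ) := by norm_num
  rw [h2, h3] at h
  simp only [ENNReal.rpow_natCast] at h
  rw [h]
  refine lintegral_congr fun a => ?_
  rw [Real.enorm_eq_ofReal_abs, ← ENNReal.ofReal_pow (abs_nonneg _), sq_abs]

theorem memLp_two_iff_lintegral {f : α → ℝ} (hf : Measurable f) :
    MemLp f 2 μ ↔ ∫⁻ a, ENNReal.ofReal (f a ^ 2) ∂μ < ⊤ := by
  rw [← sq_eLpNorm_two, ENNReal.pow_lt_top_iff]
  simp [MemLp, hf.aestronglyMeasurable]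

theorem memLp_add_measure {f : α → ℝ} (hf : Measurable f) {ν : Measure α}
    (hμ : MemLp f 2 μ) (hν : MemLp f 2 ν) : MemLp f 2 (μ + ν) := by
  rw [memLp_two_iff_lintegral hf] at *
  rw [lintegral_add_measure]
  exact ENNReal.add_lt_top.2 ⟨hμ, hν⟩

theorem enorm_eq_eLpNorm_two {F : Type*} [NormedAddCommGroup F] {f : α → ℝ} (hf : MemLp f 2 μ)
    {v : F} (hv : ‖v‖ ^ 2 = ∫ a, f a ^ 2 ∂μ) : ‖v‖ₑ = eLpNorm f 2 μ := by
  refine (ENNReal.pow_right_strictMono two_ne_zero).injective ?_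
  rw [sq_eLpNorm_two, ← ofReal_integral_eq_lintegral_ofReal hf.integrable_sq
    (ae_of_all _ fun a => sq_nonneg _), ← hv, ENNReal.ofReal_pow (norm_nonneg _), ofReal_norm]

theorem norm_sq_eq_of_enorm_eq {F : Type*} [NormedAddCommGroup F] {f : α → ℝ} (hf : MemLp f 2 μ)
    {v : F} (hv : ‖v‖ₑ = eLpNorm f 2 μ) : ‖v‖ ^ 2 = ∫ a, f a ^ 2 ∂μ := by
  have h : ENNReal.ofReal (‖v‖ ^ 2) = ENNReal.ofReal (∫ a, f a ^ 2 ∂μ) := by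
    rw [ENNReal.ofReal_pow (norm_nonneg _), ofReal_norm, hv, sq_eLpNorm_two,
      ← ofReal_integral_eq_lintegral_ofReal hf.integrable_sq (ae_of_all _ fun a => sq_nonneg _)]
  exact (ENNReal.ofReal_eq_ofReal_iff (by positivity)
    (integral_nonneg fun a => sq_nonneg _)).1 h

theorem eLpNorm_two_withDensity {f g : α → ℝ} (hf : Measurable f) (hg : Measurable g) :
    eLpNorm f 2 (μ.withDensity fun a => ENNReal.ofReal (g a ^ 2)) = eLpNorm (f * g) 2 μ := by
  refine (ENNReal.pow_right_strictMono two_ne_zero).injective ?_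
  rw [sq_eLpNorm_two, sq_eLpNorm_two, lintegral_withDensity_eq_lintegral_mul _ (by fun_prop)
    (by fun_prop)]
  refine lintegral_congr fun a => ?_
  simp only [Pi.mul_apply]
  rw [← ENNReal.ofReal_mul (sq_nonneg _), mul_pow, mul_comm]

/-- On a finite measure, Hölder bounds the L¹ norm by a constant multiple of the L² norm. -/
theorem tendsto_integral_of_eLpNorm_two [IsFiniteMeasure μ] {f : α → ℝ} {u : ℕ → α → ℝ}
    (hf : MemLp f 2 μ) (hu : ∀ n, MemLp (u n) 2 μ)
    (h : Tendsto (fun n => eLpNorm (f - u n) 2 μ) atTop (𝓝 0)) :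
    Tendsto (fun n => ∫ a, u n a ∂μ) atTop (𝓝 (∫ a, f a ∂μ)) := by
  refine tendsto_integral_of_L1' f hf.1 (Eventually.of_forall fun n =>
    (hu n).integrable (by norm_num)) ?_
  set K : ℝ≥0∞ := μ Set.univ ^ (1 / (1 : ℝ≥0∞).toReal - 1 / (2 : ℝ≥0∞).toReal)
  have hK : K ≠ ⊤ := ENNReal.rpow_ne_top_of_nonneg (by norm_num) (measure_ne_top _ _)
  have h0 : Tendsto (fun n => eLpNorm (f - u n) 2 μ * K) atTop (𝓝 0) := by
    simpa using ENNReal.Tendsto.mul_const h (Or.inr hK)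
  refine tendsto_of_tendsto_of_tendsto_of_le_of_le tendsto_const_nhds h0 (fun _ => zero_le) ?_
  intro n
  change eLpNorm (u n - f) 1 μ ≤ _
  rw [eLpNorm_sub_comm]
  exact eLpNorm_le_eLpNorm_mul_rpow_measure_univ (by norm_num) (hf.1.sub (hu n).1)

end SquareIntegrable

/-! ### Extending a real functional calculus to square-integrable functions -/

variable {H : Type*} [NormedAddCommGroup H] [InnerProductSpace ℂ H] [CompleteSpace H]

variable (H) in
/-- A representation by self-adjoint operators of an algebra `ι` of bounded measurable functions
which is dense in `L²` of every finite measure, given with its scalar spectral measures. -/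
structure Calculus (α : Type*) [MeasurableSpace α] (ι : Type*) [CommRing ι] [Algebra ℝ ι] where
  fn : ι →ₐ[ℝ] (α → ℝ)
  op : ι →ₐ[ℝ] (H →L[ℂ] H)
  meas : H → Measure α
  finite : ∀ ξ, IsFiniteMeasure (meas ξ)
  measurable : ∀ i, Measurable (fn i)
  bounded : ∀ i, ∃ C : ℝ, ∀ a, |fn i a| ≤ C
  isSelfAdjoint : ∀ i, IsSelfAdjoint (op i)
  inner_op : ∀ i ξ, inner ℂ ξ (op i ξ) = ((∫ a, fn i a ∂(meas ξ) : ℝ) : ℂ)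
  dense : ∀ (μ : Measure α) [IsFiniteMeasure μ] (f : α → ℝ), MemLp f 2 μ → ∀ ε : ℝ≥0∞, ε ≠ 0 →
    ∃ i, eLpNorm (f - fn i) 2 μ ≤ ε

namespace Calculus

variable {α : Type*} [MeasurableSpace α] {ι : Type*} [CommRing ι] [Algebra ℝ ι]
  (S : Calculus H α ι)

instance (ξ : H) : IsFiniteMeasure (S.meas ξ) := S.finite ξ

theorem memLp_fn (i : ι) (p : ℝ≥0∞) (μ : Measure α) [IsFiniteMeasure μ] : MemLp (S.fn i) p μ := by
  obtain ⟨C, hC⟩ := S.bounded i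
  exact MemLp.of_bound (S.measurable i).aestronglyMeasurable C (ae_of_all _ hC)

theorem inner_op_left (i : ι) (ξ η : H) : inner ℂ (S.op i ξ) η = inner ℂ ξ (S.op i η) :=
  ContinuousLinearMap.isSelfAdjoint_iff_isSymmetric.1 (S.isSelfAdjoint i) ξ η

theorem op_mul_apply (i j : ι) (ξ : H) : S.op (i * j) ξ = S.op i (S.op j ξ) := by
  rw [map_mul]; rfl

theorem norm_op_sq (i : ι) (ξ : H) : ‖S.op i ξ‖ ^ 2 = ∫ a, S.fn i a ^ 2 ∂(S.meas ξ) := by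
  have h := S.inner_op (i * i) ξ
  rw [op_mul_apply, ← inner_op_left, inner_self_eq_norm_sq_to_K, map_mul] at h
  have h' : ((‖S.op i ξ‖ ^ 2 : ℝ) : ℂ) = ((∫ a, S.fn i a ^ 2 ∂(S.meas ξ) : ℝ) : ℂ) := by
    simpa [sq] using h
  exact_mod_cast h'

theorem enorm_op (i : ι) (ξ : H) : ‖S.op i ξ‖ₑ = eLpNorm (S.fn i) 2 (S.meas ξ) :=
  enorm_eq_eLpNorm_two (S.memLp_fn i 2 _) (S.norm_op_sq i ξ)

theorem enorm_op_sub (i j : ι) (ξ : H) :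
    ‖S.op i ξ - S.op j ξ‖ₑ = eLpNorm (S.fn i - S.fn j) 2 (S.meas ξ) := by
  rw [← map_sub, ← enorm_op, map_sub]; rfl

/-- `u` approximates `f` in `L²(μ)`. -/
def Approx (f : α → ℝ) (u : ℕ → ι) (μ : Measure α) : Prop :=
  Tendsto (fun n => eLpNorm (f - S.fn (u n)) 2 μ) atTop (𝓝 0)

variable {S}

theorem Approx.mono {f : α → ℝ} {u : ℕ → ι} {μ ν : Measure α} (h : S.Approx f u μ) (hν : ν ≤ μ) :
    S.Approx f u ν :=
  tendsto_of_tendsto_of_tendsto_of_le_of_le tendsto_const_nhds h (fun _ => zero_le)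
    fun _ => eLpNorm_mono_measure _ hν

theorem Approx.tendsto_integral {f : α → ℝ} {u : ℕ → ι} {μ : Measure α} [IsFiniteMeasure μ]
    (h : S.Approx f u μ) (hf : MemLp f 2 μ) :
    Tendsto (fun n => ∫ a, S.fn (u n) a ∂μ) atTop (𝓝 (∫ a, f a ∂μ)) :=
  tendsto_integral_of_eLpNorm_two hf (fun _ => S.memLp_fn _ _ _) h

variable (S)

theorem exists_approx {f : α → ℝ} {μ : Measure α} [IsFiniteMeasure μ] (hf : MemLp f 2 μ) :
    ∃ u, S.Approx f u μ := by
  have h : ∀ n : ℕ, ∃ i, eLpNorm (f - S.fn i) 2 μ ≤ ((n : ℝ≥0∞) + 1)⁻¹ := fun n =>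
    S.dense μ f hf _ (by simp)
  choose u hu using h
  refine ⟨u, tendsto_of_tendsto_of_tendsto_of_le_of_le tendsto_const_nhds ?_
    (fun _ => zero_le) hu⟩
  have := ENNReal.tendsto_inv_nat_nhds_zero.comp (tendsto_add_atTop_nat 1)
  refine this.congr fun n => ?_
  simp

/-- The indicator of B is approximated in L²(μ + ν), so that one sequence serves both measures. The
same device recurs below whenever several vectors are treated at once. -/
theorem measure_ext {μ ν : Measure α} [IsFiniteMeasure μ] [IsFiniteMeasure ν]
    (h : ∀ i, ∫ a, S.fn i a ∂μ = ∫ a, S.fn i a ∂ν) : μ = ν := by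
  ext B hB
  have hm : ∀ (ρ : Measure α) [IsFiniteMeasure ρ], MemLp (B.indicator fun _ => (1 : ℝ)) 2 ρ :=
    fun ρ _ => (memLp_const 1).indicator hB
  obtain ⟨u, hu⟩ := S.exists_approx (hm (μ + ν))
  have h1 := (hu.mono (Measure.le_add_right le_rfl)).tendsto_integral (hm μ)
  have h2 := (hu.mono (Measure.le_add_left le_rfl)).tendsto_integral (hm ν)
  simp only [h] at h1
  have h3 := tendsto_nhds_unique h1 h2
  rw [integral_indicator_const _ hB, integral_indicator_const _ hB] at h3
  simpa [measureReal_def, ENNReal.toReal_eq_toReal_iff'] using h3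

/-- `v` is the value at `ξ` of the extended calculus at `f`. -/
def IsVec (f : α → ℝ) (ξ v : H) : Prop :=
  ∀ i, ‖v - S.op i ξ‖ₑ ≤ eLpNorm (f - S.fn i) 2 (S.meas ξ)

open Classical in
/-- The vector `f(S) ξ`, defined for `f` in `L²` of the scalar measure of `ξ`. -/
def vec (f : α → ℝ) (ξ : H) : H := if h : ∃ v, S.IsVec f ξ v then h.choose else 0

variable {S}

/-- Testing the bound in `IsVec` along u shows that v is the limit of every approximating sequence;
in particular v is unique. -/
theorem Approx.tendsto_isVec {f : α → ℝ} {u : ℕ → ι} {ξ v : H} (h : S.Approx f u (S.meas ξ))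
    (hv : S.IsVec f ξ v) : Tendsto (fun n => S.op (u n) ξ) atTop (𝓝 v) := by
  rw [tendsto_iff_edist_tendsto_0]
  refine tendsto_of_tendsto_of_tendsto_of_le_of_le tendsto_const_nhds h (fun _ => zero_le) ?_
  intro n
  change edist _ _ ≤ _
  rw [edist_comm, edist_eq_enorm_sub]
  exact hv _

variable (S)

/-- By `enorm_op_sub` the map `fn i ↦ op i ξ` is isometric for the L² norm of the scalar measure, so
an approximating sequence goes to a Cauchy sequence, whose limit inherits the bound. -/
theorem exists_isVec {f : α → ℝ} {ξ : H} (hf : MemLp f 2 (S.meas ξ)) : ∃ v, S.IsVec f ξ v := by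
  obtain ⟨u, hu⟩ := S.exists_approx hf
  have hle : ∀ n i, ‖S.op (u n) ξ - S.op i ξ‖ₑ ≤
      eLpNorm (f - S.fn (u n)) 2 (S.meas ξ) + eLpNorm (f - S.fn i) 2 (S.meas ξ) := by
    intro n i
    rw [enorm_op_sub, eLpNorm_sub_comm f]
    have : S.fn (u n) - S.fn i = (S.fn (u n) - f) + (f - S.fn i) := by abel
    rw [this]
    exact eLpNorm_add_le ((S.memLp_fn _ 2 _).1.sub hf.1) (hf.1.sub (S.memLp_fn _ 2 _).1)
      (by norm_num)
  have hc : CauchySeq fun n => S.op (u n) ξ := by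
    rw [EMetric.cauchySeq_iff]
    intro ε hε
    have hev : ∀ᶠ n in atTop, eLpNorm (f - S.fn (u n)) 2 (S.meas ξ) < ε / 2 :=
      hu.eventually_lt_const (ENNReal.half_pos hε.ne')
    obtain ⟨N, hN⟩ := eventually_atTop.1 hev
    refine ⟨N, fun m hm n hn => ?_⟩
    rw [edist_eq_enorm_sub]
    calc _ ≤ _ := hle m (u n)
      _ < ε / 2 + ε / 2 := ENNReal.add_lt_add (hN m hm) (hN n hn)
      _ = ε := ENNReal.add_halves ε
  obtain ⟨v, hv⟩ := cauchySeq_tendsto_of_complete hc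
  refine ⟨v, fun i => ?_⟩
  have h1 : Tendsto (fun n => ‖S.op (u n) ξ - S.op i ξ‖ₑ) atTop (𝓝 ‖v - S.op i ξ‖ₑ) :=
    (continuous_enorm.tendsto _).comp (hv.sub_const _)
  have h2 : Tendsto (fun n => eLpNorm (f - S.fn (u n)) 2 (S.meas ξ) +
      eLpNorm (f - S.fn i) 2 (S.meas ξ)) atTop (𝓝 (0 + eLpNorm (f - S.fn i) 2 (S.meas ξ))) :=
    hu.add tendsto_const_nhds
  rw [zero_add] at h2
  exact le_of_tendsto_of_tendsto' h1 h2 fun n => hle n i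

theorem isVec_vec {f : α → ℝ} {ξ : H} (hf : MemLp f 2 (S.meas ξ)) : S.IsVec f ξ (S.vec f ξ) := by
  have h := S.exists_isVec hf
  rw [vec, dif_pos h]
  exact h.choose_spec

variable {S}

theorem Approx.tendsto_vec {f : α → ℝ} {u : ℕ → ι} {ξ : H} (h : S.Approx f u (S.meas ξ))
    (hf : MemLp f 2 (S.meas ξ)) : Tendsto (fun n => S.op (u n) ξ) atTop (𝓝 (S.vec f ξ)) :=
  h.tendsto_isVec (S.isVec_vec hf)

theorem Approx.vec_eq {f : α → ℝ} {u : ℕ → ι} {ξ v : H} (h : S.Approx f u (S.meas ξ))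
    (hf : MemLp f 2 (S.meas ξ)) (hv : Tendsto (fun n => S.op (u n) ξ) atTop (𝓝 v)) :
    S.vec f ξ = v :=
  tendsto_nhds_unique (h.tendsto_vec hf) hv

variable (S)

theorem vec_fn (i : ι) (ξ : H) : S.vec (S.fn i) ξ = S.op i ξ := by
  have h : S.Approx (S.fn i) (fun _ => i) (S.meas ξ) := by simp [Approx]
  exact h.vec_eq (S.memLp_fn _ _ _) tendsto_const_nhds

theorem vec_one (ξ : H) : S.vec 1 ξ = ξ := by
  have := S.vec_fn 1 ξ
  rwa [map_one, map_one] at this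

theorem enorm_vec {f : α → ℝ} {ξ : H} (hf : MemLp f 2 (S.meas ξ)) :
    ‖S.vec f ξ‖ₑ = eLpNorm f 2 (S.meas ξ) := by
  apply le_antisymm
  · simpa using S.isVec_vec hf 0
  · obtain ⟨u, hu⟩ := S.exists_approx hf
    have h1 : Tendsto (fun n => eLpNorm (f - S.fn (u n)) 2 (S.meas ξ) + ‖S.op (u n) ξ‖ₑ) atTop
        (𝓝 (0 + ‖S.vec f ξ‖ₑ)) :=
      hu.add ((continuous_enorm.tendsto _).comp (hu.tendsto_vec hf))
    rw [zero_add] at h1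
    refine ge_of_tendsto' h1 fun n => ?_
    rw [enorm_op]
    calc eLpNorm f 2 (S.meas ξ) = eLpNorm ((f - S.fn (u n)) + S.fn (u n)) 2 (S.meas ξ) := by
          rw [sub_add_cancel]
      _ ≤ _ := eLpNorm_add_le (hf.1.sub (S.memLp_fn _ 2 _).1) (S.memLp_fn _ 2 _).1 (by norm_num)

theorem norm_vec_sq {f : α → ℝ} {ξ : H} (hf : MemLp f 2 (S.meas ξ)) :
    ‖S.vec f ξ‖ ^ 2 = ∫ a, f a ^ 2 ∂(S.meas ξ) :=
  norm_sq_eq_of_enorm_eq hf (S.enorm_vec hf)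

theorem vec_congr {f g : α → ℝ} {ξ : H} (h : f =ᵐ[S.meas ξ] g) : S.vec f ξ = S.vec g ξ := by
  have : S.IsVec f ξ = S.IsVec g ξ := by
    ext v
    refine forall_congr' fun i => ?_
    rw [eLpNorm_congr_ae (h.sub (ae_eq_refl _))]
  unfold vec
  rw [this]

theorem vec_add_fun {f g : α → ℝ} {ξ : H} (hf : MemLp f 2 (S.meas ξ))
    (hg : MemLp g 2 (S.meas ξ)) : S.vec (f + g) ξ = S.vec f ξ + S.vec g ξ := by
  obtain ⟨u, hu⟩ := S.exists_approx hf
  obtain ⟨w, hw⟩ := S.exists_approx hg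
  have h : S.Approx (f + g) (fun n => u n + w n) (S.meas ξ) := by
    have h0 := hu.add hw
    rw [zero_add] at h0
    refine tendsto_of_tendsto_of_tendsto_of_le_of_le tendsto_const_nhds h0 (fun _ => zero_le) ?_
    intro n
    dsimp only
    rw [map_add, add_sub_add_comm]
    exact eLpNorm_add_le (hf.1.sub (S.memLp_fn _ 2 _).1) (hg.1.sub (S.memLp_fn _ 2 _).1)
      (by norm_num)
  refine h.vec_eq (hf.add hg) ?_
  simpa using (hu.tendsto_vec hf).add (hw.tendsto_vec hg)

theorem vec_smul_fun {f : α → ℝ} {ξ : H} (hf : MemLp f 2 (S.meas ξ)) (c : ℝ) :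
    S.vec (c • f) ξ = c • S.vec f ξ := by
  obtain ⟨u, hu⟩ := S.exists_approx hf
  have h : S.Approx (c • f) (fun n => c • u n) (S.meas ξ) := by
    have h0 := ENNReal.Tendsto.const_mul (a := ‖c‖ₑ) hu (Or.inr enorm_ne_top)
    rw [mul_zero] at h0
    refine h0.congr fun n => ?_
    rw [map_smul, ← smul_sub, eLpNorm_const_smul]
  refine h.vec_eq (hf.const_smul c) ?_
  simpa using (hu.tendsto_vec hf).const_smul c

theorem vec_sub_fun {f g : α → ℝ} {ξ : H} (hf : MemLp f 2 (S.meas ξ))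
    (hg : MemLp g 2 (S.meas ξ)) : S.vec (f - g) ξ = S.vec f ξ - S.vec g ξ := by
  have h := S.vec_add_fun hf (hg.const_smul (-1 : ℝ))
  rw [S.vec_smul_fun hg] at h
  simpa [sub_eq_add_neg] using h

/-- The real part comes from polarizing `norm_vec_sq`. The imaginary part is a limit of those of ⟨ξ,
op(u w) ξ⟩, which are zero because the calculus is commutative and real. -/
theorem inner_vec_vec {f g : α → ℝ} {ξ : H} (hf : MemLp f 2 (S.meas ξ))
    (hg : MemLp g 2 (S.meas ξ)) :
    inner ℂ (S.vec f ξ) (S.vec g ξ) = ((∫ a, f a * g a ∂(S.meas ξ) : ℝ) : ℂ) := by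
  have hfg : Integrable (fun a => f a * g a) (S.meas ξ) := hf.integrable_mul hg
  apply Complex.ext
  · have h1 := norm_add_sq (𝕜 := ℂ) (S.vec f ξ) (S.vec g ξ)
    rw [← S.vec_add_fun hf hg, S.norm_vec_sq (hf.add hg), S.norm_vec_sq hf, S.norm_vec_sq hg] at h1
    have h2 : ∫ a, (f + g) a ^ 2 ∂(S.meas ξ) = ∫ a, f a ^ 2 ∂(S.meas ξ) +
        2 * ∫ a, f a * g a ∂(S.meas ξ) + ∫ a, g a ^ 2 ∂(S.meas ξ) := by
      rw [← integral_const_mul, ← integral_add hf.integrable_sq (hfg.const_mul 2),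
        ← integral_add (f := fun a => f a ^ 2 + 2 * (f a * g a))
          (hf.integrable_sq.add (hfg.const_mul 2)) hg.integrable_sq]
      refine integral_congr_ae (ae_of_all _ fun a => ?_)
      simp only [Pi.add_apply]
      ring
    rw [h2] at h1
    simp only [RCLike.re_eq_complex_re] at h1
    rw [Complex.ofReal_re]
    linarith
  · rw [Complex.ofReal_im]
    obtain ⟨u, hu⟩ := S.exists_approx hf
    obtain ⟨w, hw⟩ := S.exists_approx hg
    have h1 : Tendsto (fun n => (inner ℂ (S.op (u n) ξ) (S.op (w n) ξ)).im) atTop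
        (𝓝 (inner ℂ (S.vec f ξ) (S.vec g ξ)).im) :=
      (Complex.continuous_im.tendsto _).comp ((hu.tendsto_vec hf).inner (hw.tendsto_vec hg))
    refine tendsto_nhds_unique h1 ?_
    have h2 : ∀ n, (inner ℂ (S.op (u n) ξ) (S.op (w n) ξ)).im = 0 := by
      intro n
      rw [inner_op_left, ← op_mul_apply, inner_op, Complex.ofReal_im]
    simp [h2]

theorem inner_self_vec {f : α → ℝ} {ξ : H} (hf : MemLp f 2 (S.meas ξ)) :
    inner ℂ ξ (S.vec f ξ) = ((∫ a, f a ∂(S.meas ξ) : ℝ) : ℂ) := by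
  have h1 : MemLp (1 : α → ℝ) 2 (S.meas ξ) := memLp_const 1
  have h := S.inner_vec_vec h1 hf
  rw [vec_one] at h
  simpa using h

/-- This is the parallelogram law for ξ ± η. The domination is what makes the maximal domain of f(S)
closed under addition. -/
theorem meas_add_le (ξ η : H) :
    S.meas (ξ + η) ≤ (2 : ℝ≥0) • S.meas ξ + (2 : ℝ≥0) • S.meas η := by
  have h : S.meas (ξ + η) + S.meas (ξ - η) = (2 : ℝ≥0) • S.meas ξ + (2 : ℝ≥0) • S.meas η := by
    refine S.measure_ext fun i => ?_
    have hi : ∀ (μ : Measure α) [IsFiniteMeasure μ], Integrable (S.fn i) μ := fun μ _ =>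
      (S.memLp_fn i 1 μ).integrable le_rfl
    rw [integral_add_measure (hi _) (hi _), integral_add_measure (hi _) (hi _),
      integral_smul_nnreal_measure, integral_smul_nnreal_measure]
    have h1 : ((∫ a, S.fn i a ∂S.meas (ξ + η) + ∫ a, S.fn i a ∂S.meas (ξ - η) : ℝ) : ℂ) =
        ((2 * ∫ a, S.fn i a ∂S.meas ξ + 2 * ∫ a, S.fn i a ∂S.meas η : ℝ) : ℂ) := by
      push_cast
      rw [← inner_op, ← inner_op, ← inner_op, ← inner_op]
      simp only [map_add, map_sub, inner_add_left, inner_sub_left, inner_add_right, inner_sub_right]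
      ring
    exact Complex.ofReal_injective h1
  rw [← h]
  exact Measure.le_add_right le_rfl

theorem meas_smul (c : ℂ) (ξ : H) : S.meas (c • ξ) = (‖c‖₊ ^ 2) • S.meas ξ := by
  refine S.measure_ext fun i => ?_
  rw [integral_smul_nnreal_measure]
  have h1 : ((∫ a, S.fn i a ∂S.meas (c • ξ) : ℝ) : ℂ) =
      ((‖c‖ ^ 2 * ∫ a, S.fn i a ∂S.meas ξ : ℝ) : ℂ) := by
    push_cast
    rw [← inner_op, ← inner_op, map_smul, inner_smul_left, inner_smul_right, ← mul_assoc,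
      mul_comm _ c, Complex.mul_conj, Complex.normSq_eq_norm_sq]
    push_cast; rfl
  exact_mod_cast h1

theorem meas_zero : S.meas 0 = 0 := by simpa using S.meas_smul 0 0

theorem meas_univ (ξ : H) : S.meas ξ Set.univ = ‖ξ‖ₑ ^ 2 := by
  have h1 : MemLp (1 : α → ℝ) 2 (S.meas ξ) := memLp_const 1
  have h := S.enorm_vec h1
  rw [vec_one] at h
  rw [h, sq_eLpNorm_two]
  simp

theorem memLp_add_vector {f : α → ℝ} (hf : Measurable f) {ξ η : H} (hξ : MemLp f 2 (S.meas ξ))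
    (hη : MemLp f 2 (S.meas η)) : MemLp f 2 (S.meas (ξ + η)) := by
  refine MemLp.mono_measure (S.meas_add_le ξ η) (memLp_add_measure hf ?_ ?_)
  · exact hξ.smul_measure (c := ((2 : ℝ≥0) : ℝ≥0∞)) ENNReal.coe_ne_top
  · exact hη.smul_measure (c := ((2 : ℝ≥0) : ℝ≥0∞)) ENNReal.coe_ne_top

theorem memLp_smul_vector {f : α → ℝ} {ξ : H} (c : ℂ) (hξ : MemLp f 2 (S.meas ξ)) :
    MemLp f 2 (S.meas (c • ξ)) := by
  rw [meas_smul]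
  exact hξ.smul_measure (c := ((‖c‖₊ ^ 2 : ℝ≥0) : ℝ≥0∞)) ENNReal.coe_ne_top

theorem vec_add {f : α → ℝ} (hf : Measurable f) {ξ η : H} (hξ : MemLp f 2 (S.meas ξ))
    (hη : MemLp f 2 (S.meas η)) : S.vec f (ξ + η) = S.vec f ξ + S.vec f η := by
  have hs := memLp_add_vector S hf hξ hη
  obtain ⟨u, hu⟩ := S.exists_approx (memLp_add_measure hf hs (memLp_add_measure hf hξ hη))
  refine (hu.mono (Measure.le_add_right le_rfl)).vec_eq hs ?_
  have h2 := hu.mono (Measure.le_add_left le_rfl)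
  simpa using ((h2.mono (Measure.le_add_right le_rfl)).tendsto_vec hξ).add
    ((h2.mono (Measure.le_add_left le_rfl)).tendsto_vec hη)

/-- The extended calculus commutes with every operator which commutes with the original one. -/
theorem vec_map {f : α → ℝ} (hf : Measurable f) (W : H →L[ℂ] H)
    (hW : ∀ i ξ, S.op i (W ξ) = W (S.op i ξ)) {ξ : H} (hξ : MemLp f 2 (S.meas ξ))
    (hWξ : MemLp f 2 (S.meas (W ξ))) : S.vec f (W ξ) = W (S.vec f ξ) := by
  obtain ⟨u, hu⟩ := S.exists_approx (memLp_add_measure hf hWξ hξ)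
  refine (hu.mono (Measure.le_add_right le_rfl)).vec_eq hWξ ?_
  simp only [hW]
  exact (W.continuous.tendsto _).comp
    ((hu.mono (Measure.le_add_left le_rfl)).tendsto_vec hξ)

theorem vec_smul {f : α → ℝ} (hf : Measurable f) {ξ : H} (c : ℂ) (hξ : MemLp f 2 (S.meas ξ)) :
    S.vec f (c • ξ) = c • S.vec f ξ :=
  S.vec_map hf (c • (1 : H →L[ℂ] H)) (by simp) hξ (memLp_smul_vector S c hξ)

theorem inner_vec_left {f : α → ℝ} (hf : Measurable f) {ξ η : H} (hξ : MemLp f 2 (S.meas ξ))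
    (hη : MemLp f 2 (S.meas η)) : inner ℂ (S.vec f ξ) η = inner ℂ ξ (S.vec f η) := by
  obtain ⟨u, hu⟩ := S.exists_approx (memLp_add_measure hf hξ hη)
  have h1 := ((hu.mono (Measure.le_add_right le_rfl)).tendsto_vec hξ).inner
    (tendsto_const_nhds (x := η)) (𝕜 := ℂ)
  have h2 := (tendsto_const_nhds (x := ξ)).inner
    ((hu.mono (Measure.le_add_left le_rfl)).tendsto_vec hη) (𝕜 := ℂ)
  simp only [inner_op_left] at h1
  exact tendsto_nhds_unique h1 h2

theorem memLp_fn_mul (i : ι) {f : α → ℝ} {μ : Measure α} (hf : MemLp f 2 μ) :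
    MemLp (S.fn i * f) 2 μ := by
  obtain ⟨C, hC⟩ := S.bounded i
  refine MemLp.of_le_mul (c := C) hf ((S.measurable i).aestronglyMeasurable.mul hf.1)
    (ae_of_all _ fun a => ?_)
  rw [Pi.mul_apply, norm_mul]
  exact mul_le_mul_of_nonneg_right (hC a) (norm_nonneg _)

theorem op_vec (i : ι) {f : α → ℝ} {ξ : H} (hf : MemLp f 2 (S.meas ξ)) :
    S.op i (S.vec f ξ) = S.vec (S.fn i * f) ξ := by
  obtain ⟨u, hu⟩ := S.exists_approx hf
  obtain ⟨C, hC⟩ := S.bounded i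
  have h : S.Approx (S.fn i * f) (fun n => i * u n) (S.meas ξ) := by
    have h0 := ENNReal.Tendsto.const_mul (a := ENNReal.ofReal C) hu (Or.inr ENNReal.ofReal_ne_top)
    rw [mul_zero] at h0
    refine tendsto_of_tendsto_of_tendsto_of_le_of_le tendsto_const_nhds h0 (fun _ => zero_le) ?_
    intro n
    dsimp only
    rw [map_mul, ← mul_sub]
    refine eLpNorm_le_mul_eLpNorm_of_ae_le_mul (ae_of_all _ fun a => ?_) 2
    rw [Pi.mul_apply, norm_mul]
    exact mul_le_mul_of_nonneg_right (hC a) (norm_nonneg _)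
  refine (h.vec_eq (S.memLp_fn_mul i hf) ?_).symm
  simp only [op_mul_apply]
  exact ((S.op i).continuous.tendsto _).comp (hu.tendsto_vec hf)

/-- Both sides integrate `fn i` to ⟨g(S)ξ, op i g(S)ξ⟩ = ∫ fn i · g² dμ_ξ. Domain questions for
composites thus become square-integrability of a product against one measure. -/
theorem meas_vec {g : α → ℝ} (hg : Measurable g) {ξ : H} (hξ : MemLp g 2 (S.meas ξ)) :
    S.meas (S.vec g ξ) = (S.meas ξ).withDensity fun a => ENNReal.ofReal (g a ^ 2) := by
  have : IsFiniteMeasure ((S.meas ξ).withDensity fun a => ENNReal.ofReal (g a ^ 2)) :=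
    isFiniteMeasure_withDensity ((memLp_two_iff_lintegral hg).1 hξ).ne
  refine S.measure_ext fun i => ?_
  have h := S.inner_op i (S.vec g ξ)
  rw [op_vec _ _ hξ, inner_vec_vec _ hξ (S.memLp_fn_mul i hξ)] at h
  rw [integral_withDensity_eq_integral_toReal_smul₀ (by fun_prop)
    (ae_of_all _ fun _ => ENNReal.ofReal_lt_top)]
  rw [← Complex.ofReal_inj.1 h]
  refine integral_congr_ae (ae_of_all _ fun a => ?_)
  simp only [ENNReal.toReal_ofReal (sq_nonneg _), smul_eq_mul, Pi.mul_apply]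
  ring

theorem memLp_vec_iff {f g : α → ℝ} (hf : Measurable f) (hg : Measurable g) {ξ : H}
    (hξ : MemLp g 2 (S.meas ξ)) : MemLp f 2 (S.meas (S.vec g ξ)) ↔ MemLp (f * g) 2 (S.meas ξ) := by
  rw [MemLp, MemLp, S.meas_vec hg hξ, eLpNorm_two_withDensity hf hg]
  simp [hf.aestronglyMeasurable, (hf.mul hg).aestronglyMeasurable]

/-- By `meas_vec`, approximating f by `fn i` in L² of the measure of g(S)ξ is the same as
approximating fg by `fn i * g` in L² of the measure of ξ. -/
theorem vec_vec {f g : α → ℝ} (hf : Measurable f) (hg : Measurable g) {ξ : H}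
    (hξ : MemLp g 2 (S.meas ξ)) (hfg : MemLp (f * g) 2 (S.meas ξ)) :
    S.vec f (S.vec g ξ) = S.vec (f * g) ξ := by
  have hf' := (S.memLp_vec_iff hf hg hξ).2 hfg
  obtain ⟨u, hu⟩ := S.exists_approx hf'
  refine hu.vec_eq hf' ?_
  rw [tendsto_iff_edist_tendsto_0]
  refine Tendsto.congr (fun n => ?_) hu
  rw [op_vec _ _ hξ, edist_comm, edist_eq_enorm_sub, ← vec_sub_fun _ hfg (S.memLp_fn_mul _ hξ),
    enorm_vec _ (hfg.sub (S.memLp_fn_mul _ hξ)), ← sub_mul, S.meas_vec hg hξ,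
    eLpNorm_two_withDensity (hf.sub (S.measurable _)) hg]

end Calculus

/-! ### Unbounded operators of an extended calculus -/

namespace Calculus

/-- The indicator function of a set with values `0` and `1`. -/
abbrev ind {α : Type*} (B : Set α) : α → ℝ := B.indicator 1

theorem ind_mul {α : Type*} (B : Set α) (f : α → ℝ) : ind B * f = B.indicator f := by
  ext a; by_cases h : a ∈ B <;> simp [h]

theorem mul_ind {α : Type*} (B : Set α) (f : α → ℝ) : f * ind B = B.indicator f := by
  rw [mul_comm, ind_mul]

theorem monotone_abs_le {α : Type*} (f : α → ℝ) : Monotone fun n : ℕ => {a | |f a| ≤ n} :=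
  fun _ _ hmn a (ha : |f a| ≤ _) => ha.trans (Nat.cast_le.2 hmn)

theorem iUnion_abs_le {α : Type*} (f : α → ℝ) : ⋃ n : ℕ, {a | |f a| ≤ n} = Set.univ :=
  Set.eq_univ_of_forall fun a => Set.mem_iUnion.2 (exists_nat_ge |f a|)

variable {α : Type*} [MeasurableSpace α] {ι : Type*} [CommRing ι] [Algebra ℝ ι]
  (S : Calculus H α ι)

/-- The operator `ξ ↦ f(S) ξ` on its maximal domain. -/
def pmap (f : α → ℝ) (hf : Measurable f) : H →ₗ.[ℂ] H where
  domain :=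
    { carrier := {ξ | MemLp f 2 (S.meas ξ)}
      add_mem' := fun hξ hη => memLp_add_vector S hf hξ hη
      zero_mem' := by simp [meas_zero]
      smul_mem' := fun c _ hξ => memLp_smul_vector S c hξ }
  toFun :=
    { toFun := fun ξ => S.vec f ξ
      map_add' := fun ξ η => S.vec_add hf ξ.2 η.2
      map_smul' := fun c ξ => S.vec_smul hf c ξ.2 }

variable {S} {f g : α → ℝ} {hf : Measurable f} {hg : Measurable g}

theorem mem_pmap_domain {ξ : H} : ξ ∈ (S.pmap f hf).domain ↔ MemLp f 2 (S.meas ξ) := Iff.rfl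

theorem pmap_apply (ξ : (S.pmap f hf).domain) : S.pmap f hf ξ = S.vec f ξ := rfl

theorem measurable_ind {B : Set α} (hB : MeasurableSet B) : Measurable (ind B) :=
  measurable_one.indicator hB

theorem memLp_ind {B : Set α} (hB : MeasurableSet B) (μ : Measure α) [IsFiniteMeasure μ] :
    MemLp (ind B) 2 μ :=
  (memLp_const (1 : ℝ)).indicator hB

theorem sq_norm_vec_ind {B : Set α} (hB : MeasurableSet B) (ξ : H) :
    ENNReal.ofReal (‖S.vec (ind B) ξ‖ ^ 2) = S.meas ξ B := by
  rw [ENNReal.ofReal_pow (norm_nonneg _), ofReal_norm, S.enorm_vec (memLp_ind hB _),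
    sq_eLpNorm_two]
  have : (fun a => ENNReal.ofReal (ind B a ^ 2)) = B.indicator 1 := by
    ext a; by_cases h : a ∈ B <;> simp [h]
  rw [this, lintegral_indicator_one hB]

theorem norm_vec_ind_le {B : Set α} (hB : MeasurableSet B) (ξ : H) : ‖S.vec (ind B) ξ‖ ≤ ‖ξ‖ := by
  have h : ENNReal.ofReal (‖S.vec (ind B) ξ‖ ^ 2) ≤ ENNReal.ofReal (‖ξ‖ ^ 2) := by
    rw [sq_norm_vec_ind hB, ENNReal.ofReal_pow (norm_nonneg _), ofReal_norm, ← S.meas_univ]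
    exact measure_mono (Set.subset_univ _)
  exact (sq_le_sq₀ (norm_nonneg _) (norm_nonneg _)).1
    ((ENNReal.ofReal_le_ofReal_iff (by positivity)).1 h)

theorem vec_ind_vec {B : Set α} (hB : MeasurableSet B) (hf : Measurable f) {ξ : H}
    (hξ : MemLp f 2 (S.meas ξ)) : S.vec (ind B) (S.vec f ξ) = S.vec (B.indicator f) ξ := by
  rw [S.vec_vec (measurable_ind hB) hf hξ, ind_mul]
  rw [ind_mul]; exact hξ.indicator hB

theorem memLp_vec_ind_iff {B : Set α} (hB : MeasurableSet B) (hf : Measurable f) {ξ : H} :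
    MemLp f 2 (S.meas (S.vec (ind B) ξ)) ↔ MemLp (B.indicator f) 2 (S.meas ξ) := by
  rw [S.memLp_vec_iff hf (measurable_ind hB) (memLp_ind hB _), mul_ind]

theorem vec_vec_ind {B : Set α} (hB : MeasurableSet B) (hf : Measurable f) {ξ : H}
    (hξ : MemLp (B.indicator f) 2 (S.meas ξ)) :
    S.vec f (S.vec (ind B) ξ) = S.vec (B.indicator f) ξ := by
  rw [S.vec_vec hf (measurable_ind hB) (memLp_ind hB _), mul_ind]
  rwa [mul_ind]

theorem memLp_indicator_of_bounded (hf : Measurable f) {B : Set α} (hB : MeasurableSet B) {C : ℝ}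
    (hC : ∀ a ∈ B, |f a| ≤ C) (μ : Measure α) [IsFiniteMeasure μ] :
    MemLp (B.indicator f) 2 μ := by
  refine MemLp.of_bound (hf.indicator hB).aestronglyMeasurable |C| (ae_of_all _ fun a => ?_)
  by_cases h : a ∈ B
  · simpa [h] using (hC a h).trans (le_abs_self C)
  · simp [h]

theorem tendsto_vec_ind {B : ℕ → Set α} (hB : ∀ n, MeasurableSet (B n)) (hmono : Monotone B)
    (hU : ⋃ n, B n = Set.univ) (ξ : H) :
    Tendsto (fun n => S.vec (ind (B n)) ξ) atTop (𝓝 ξ) := by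
  have h : ∀ n, ENNReal.ofReal (‖ξ - S.vec (ind (B n)) ξ‖ ^ 2) = S.meas ξ (B n)ᶜ := by
    intro n
    rw [← sq_norm_vec_ind (hB n).compl]
    have h1 : ind (B n)ᶜ = (1 : α → ℝ) - ind (B n) := by
      ext a; by_cases h : a ∈ B n <;> simp [h]
    have h2 : MemLp (1 : α → ℝ) 2 (S.meas ξ) := memLp_const 1
    rw [h1, S.vec_sub_fun h2 (memLp_ind (hB n) _), vec_one]
  have h1 : Tendsto (fun n => S.meas ξ (B n)ᶜ) atTop (𝓝 0) := by
    have := tendsto_measure_iInter_atTop (μ := S.meas ξ) (s := fun n => (B n)ᶜ)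
      (fun n => (hB n).compl.nullMeasurableSet) (fun m n hmn => Set.compl_subset_compl.2 (hmono hmn))
      ⟨0, measure_ne_top _ _⟩
    rwa [← Set.compl_iUnion, hU, Set.compl_univ, measure_empty] at this
  rw [tendsto_iff_norm_sub_tendsto_zero]
  have h2 : Tendsto (fun n => ‖ξ - S.vec (ind (B n)) ξ‖ ^ 2) atTop (𝓝 0) := by
    have := (ENNReal.tendsto_toReal ENNReal.zero_ne_top).comp (h1.congr fun n => (h n).symm)
    simpa [Function.comp_def, ENNReal.toReal_ofReal, sq_nonneg] using this
  have h3 := h2.sqrt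
  simp only [Real.sqrt_zero] at h3
  refine h3.congr fun n => ?_
  rw [Real.sqrt_sq (norm_nonneg _), norm_sub_rev]

theorem measurableSet_abs_le (hf : Measurable f) (n : ℕ) : MeasurableSet {a | |f a| ≤ n} :=
  measurableSet_le hf.abs measurable_const

variable (S) (hf) in
theorem dense_pmap_domain : Dense ((S.pmap f hf).domain : Set H) := by
  intro ξ
  refine mem_closure_of_tendsto (tendsto_vec_ind (S := S) (measurableSet_abs_le hf)
    (monotone_abs_le f) (iUnion_abs_le f) ξ) (Eventually.of_forall fun n => ?_)
  exact (memLp_vec_ind_iff (measurableSet_abs_le hf n) hf).2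
    (memLp_indicator_of_bounded hf (measurableSet_abs_le hf n) (C := n) (fun _ h => h) _)

variable (S) (hf) in
theorem isSelfAdjoint_pmap : IsSelfAdjoint (S.pmap f hf) := by
  rw [LinearPMap.isSelfAdjoint_def]
  have hd := S.dense_pmap_domain hf
  have hle : S.pmap f hf ≤ (S.pmap f hf).adjoint :=
    LinearPMap.IsFormalAdjoint.le_adjoint hd fun ξ η => S.inner_vec_left hf ξ.2 η.2
  refine (LinearPMap.eq_of_le_of_domain_eq hle (le_antisymm hle.1 fun η hη => ?_)).symm
  set w := (S.pmap f hf).adjoint ⟨η, hη⟩ with hw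
  have hadj : ∀ ξ : (S.pmap f hf).domain, inner ℂ w (ξ : H) = inner ℂ η (S.vec f ξ) := fun ξ =>
    LinearPMap.adjoint_isFormalAdjoint hd ⟨η, hη⟩ ξ
  rw [mem_pmap_domain, memLp_two_iff_lintegral hf]
  set B : ℕ → Set α := fun n => {a | |f a| ≤ n} with hBdef
  have hB : ∀ n, MeasurableSet (B n) := measurableSet_abs_le hf
  have hbd : ∀ n, ∫⁻ a in B n, ENNReal.ofReal (f a ^ 2) ∂(S.meas η) ≤ ‖w‖ₑ ^ 2 := by
    intro n
    have hm : MemLp ((B n).indicator f) 2 (S.meas η) :=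
      memLp_indicator_of_bounded hf (hB n) (C := n) (fun _ h => h) _
    have hmm : MemLp (f * (B n).indicator f) 2 (S.meas η) := by
      rw [← mul_ind, ← mul_assoc, mul_ind]
      refine memLp_indicator_of_bounded (hf.mul hf) (hB n) (C := n * n) (fun a h => ?_) _
      rw [Pi.mul_apply, abs_mul]
      exact mul_le_mul h h (abs_nonneg _) (Nat.cast_nonneg _)
    -- Testing the adjoint relation on this ζ gives ⟨w, ζ⟩ = ‖ζ‖², hence ‖ζ‖ ≤ ‖w‖ uniformly in n.
    -- Monotone convergence then makes f square-integrable for the measure of η.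
    set ζ := S.vec ((B n).indicator f) η with hζ
    have hζd : ζ ∈ (S.pmap f hf).domain := (S.memLp_vec_iff hf (hf.indicator (hB n)) hm).2 hmm
    have h1 := hadj ⟨ζ, hζd⟩
    have h2 : inner ℂ η (S.vec f ζ) = ((‖ζ‖ ^ 2 : ℝ) : ℂ) := by
      rw [hζ, S.vec_vec hf (hf.indicator (hB n)) hm hmm, S.inner_self_vec hmm, S.norm_vec_sq hm]
      congr 2
      ext a
      by_cases h : a ∈ B n <;> simp [h, sq]
    have h3 : ‖ζ‖ ^ 2 ≤ ‖w‖ * ‖ζ‖ := by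
      have h4 := norm_inner_le_norm (𝕜 := ℂ) w ζ
      rw [h1, h2, Complex.norm_real, Real.norm_of_nonneg (by positivity)] at h4
      exact h4
    have h5 : ‖ζ‖ ≤ ‖w‖ := by
      by_contra hlt
      push Not at hlt
      nlinarith [norm_nonneg w]
    have h6 : ‖ζ‖ₑ ≤ ‖w‖ₑ := by simpa [enorm_le_iff_norm_le] using h5
    calc ∫⁻ a in B n, ENNReal.ofReal (f a ^ 2) ∂(S.meas η)
        = ∫⁻ a, ENNReal.ofReal ((B n).indicator f a ^ 2) ∂(S.meas η) := by
          rw [← lintegral_indicator (hB n)]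
          refine lintegral_congr fun a => ?_
          by_cases h : a ∈ B n <;> simp [h]
      _ = ‖ζ‖ₑ ^ 2 := by rw [← sq_eLpNorm_two, hζ, S.enorm_vec hm]
      _ ≤ _ := pow_le_pow_left' h6 2
  have hlim : ∫⁻ a, ENNReal.ofReal (f a ^ 2) ∂(S.meas η) ≤ ‖w‖ₑ ^ 2 := by
    rw [← setLIntegral_univ, ← iUnion_abs_le f,
      setLIntegral_iUnion_of_directed _ (monotone_abs_le f).directed_le]
    exact iSup_le hbd
  exact hlim.trans_lt (ENNReal.pow_lt_top enorm_lt_top)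

variable (hf) in
/-- A restriction of `f(S)` whose domain contains the ranges of a sequence of spectral projections
increasing to `1` has closure `f(S)`. -/
theorem closure_eq_pmap {T : H →ₗ.[ℂ] H} (hT : T ≤ S.pmap f hf) {B : ℕ → Set α}
    (hB : ∀ n, MeasurableSet (B n)) (hmono : Monotone B) (hU : ⋃ n, B n = Set.univ)
    (hdom : ∀ n ξ, S.vec (ind (B n)) ξ ∈ T.domain) : T.closure = S.pmap f hf := by
  have hcl : (S.pmap f hf).IsClosed := (S.isSelfAdjoint_pmap hf).isClosed
  have hTc : T.IsClosable := hcl.isClosable.leIsClosable hT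
  refine LinearPMap.eq_of_eq_graph ?_
  rw [← hTc.graph_closure_eq_closure_graph]
  apply le_antisymm
  · refine Submodule.topologicalClosure_minimal _ (LinearPMap.le_graph_of_le hT) hcl
  · rintro ⟨ξ, ζ⟩ h
    obtain ⟨η, rfl, rfl⟩ := (LinearPMap.mem_graph_iff _).1 h
    have hη : MemLp f 2 (S.meas (η : H)) := η.2
    change ((η : H), S.pmap f hf η) ∈ closure (T.graph : Set (H × H))
    -- The spectral cut-offs commute with f(S), so both coordinates of the graph point are
    -- approximated at once.
    refine mem_closure_of_tendsto (f := fun n => (S.vec (ind (B n)) η, S.vec (ind (B n))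
      (S.vec f η))) (b := atTop) ?_ (Eventually.of_forall fun n => ?_)
    · exact (tendsto_vec_ind hB hmono hU _).prodMk_nhds (tendsto_vec_ind hB hmono hU _)
    · refine (LinearPMap.mem_graph_iff _).2 ⟨⟨_, hdom n η⟩, rfl, ?_⟩
      rw [hT.2 (x := ⟨_, hdom n η⟩) (y := ⟨_, hT.1 (hdom n η)⟩) rfl, pmap_apply]
      dsimp only
      rw [vec_vec_ind (hB n) hf (hη.indicator (hB n)), vec_ind_vec (hB n) hf hη]

/-! ### The spectral measure of a calculus -/

variable (S) in
/-- The spectral projection of a measurable set. -/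
def projOp (B : Set α) (hB : MeasurableSet B) : H →L[ℂ] H :=
  LinearMap.mkContinuous
    { toFun := fun ξ => S.vec (ind B) ξ
      map_add' := fun _ _ => S.vec_add (measurable_ind hB) (memLp_ind hB _) (memLp_ind hB _)
      map_smul' := fun c _ => S.vec_smul (measurable_ind hB) c (memLp_ind hB _) } 1
    fun ξ => by simpa using norm_vec_ind_le hB ξ

theorem projOp_apply {B : Set α} (hB : MeasurableSet B) (ξ : H) :
    S.projOp B hB ξ = S.vec (ind B) ξ := rfl

theorem projOp_inter {B C : Set α} (hB : MeasurableSet B) (hC : MeasurableSet C) :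
    S.projOp (B ∩ C) (hB.inter hC) = S.projOp B hB * S.projOp C hC := by
  ext ξ
  change S.vec (ind (B ∩ C)) ξ = S.vec (ind B) (S.vec (ind C) ξ)
  rw [vec_ind_vec hB (measurable_ind hC) (memLp_ind hC _), ind, ind, Set.indicator_indicator]

theorem isStarProjection_projOp {B : Set α} (hB : MeasurableSet B) :
    IsStarProjection (S.projOp B hB) where
  isIdempotentElem := by
    have h := projOp_inter (S := S) hB hB
    simp only [Set.inter_self] at h
    exact h.symm
  isSelfAdjoint := ContinuousLinearMap.isSelfAdjoint_iff_isSymmetric.2 fun _ _ =>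
    S.inner_vec_left (measurable_ind hB) (memLp_ind hB _) (memLp_ind hB _)

/-- The squared distance from a partial sum to the limit is the scalar measure of the uncovered part
of the union, which tends to 0 by countable additivity. -/
theorem hasSum_projOp {B : ℕ → Set α} (hB : ∀ n, MeasurableSet (B n))
    (hd : Pairwise (Function.onFun Disjoint B)) (ξ : H) :
    HasSum (fun n => S.projOp (B n) (hB n) ξ) (S.projOp (⋃ n, B n) (.iUnion hB) ξ) := by
  have hfin : ∀ F : Finset ℕ, ∑ n ∈ F, S.projOp (B n) (hB n) ξ =
      S.vec (ind (⋃ n ∈ F, B n)) ξ := by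
    intro F
    induction F using Finset.induction_on with
    | empty =>
      simp only [Finset.sum_empty, Finset.notMem_empty, Set.iUnion_false, Set.iUnion_empty]
      have h := S.vec_fn 0 ξ
      rw [map_zero, map_zero] at h
      exact (congrArg (fun f => S.vec f ξ) (Set.indicator_empty _)).trans h |>.symm
    | insert m F hm ih =>
      rw [Finset.sum_insert hm, ih, projOp_apply, Finset.set_biUnion_insert,
        ← S.vec_add_fun (memLp_ind (hB m) _)
          (memLp_ind (F.measurableSet_biUnion fun n _ => hB n) _), ind, ind, ind,
        Set.indicator_union_of_disjoint]
      · rfl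
      · exact Set.disjoint_iUnion₂_right.2 fun n hn => hd (fun h => hm (h ▸ hn))
  have hU : MeasurableSet (⋃ n, B n) := .iUnion hB
  have hFm : ∀ F : Finset ℕ, MeasurableSet (⋃ n ∈ F, B n) := fun F =>
    F.measurableSet_biUnion fun n _ => hB n
  have hdist : ∀ F : Finset ℕ, ENNReal.ofReal
      (‖∑ n ∈ F, S.projOp (B n) (hB n) ξ - S.projOp (⋃ n, B n) hU ξ‖ ^ 2) =
      S.meas ξ ((⋃ n, B n) \ ⋃ n ∈ F, B n) := by
    intro F
    rw [hfin, projOp_apply, norm_sub_rev, ← S.vec_sub_fun (memLp_ind hU _) (memLp_ind (hFm F) _),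
      ← sq_norm_vec_ind (hU.diff (hFm F)), ind, ind, ind,
      Set.indicator_sdiff (Set.iUnion₂_subset fun n _ => Set.subset_iUnion B n)]
  have h1 : Tendsto (fun F : Finset ℕ => S.meas ξ ((⋃ n, B n) \ ⋃ n ∈ F, B n)) atTop (𝓝 0) := by
    have hs : HasSum (fun n => S.meas ξ (B n)) (S.meas ξ (⋃ n, B n)) := by
      rw [measure_iUnion hd hB]; exact ENNReal.summable.hasSum
    have h2 : Tendsto (fun F : Finset ℕ => S.meas ξ (⋃ n, B n) - ∑ n ∈ F, S.meas ξ (B n)) atTop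
        (𝓝 (S.meas ξ (⋃ n, B n) - S.meas ξ (⋃ n, B n))) :=
      ENNReal.Tendsto.sub tendsto_const_nhds hs (Or.inl (measure_ne_top _ _))
    rw [tsub_self] at h2
    refine h2.congr fun F => ?_
    rw [measure_sdiff (Set.iUnion₂_subset fun n _ => Set.subset_iUnion B n)
      (hFm F).nullMeasurableSet (measure_ne_top _ _),
      measure_biUnion_finset (fun m _ n _ hmn => hd hmn) fun n _ => hB n]
  rw [HasSum, SummationFilter.unconditional_filter, tendsto_iff_norm_sub_tendsto_zero]
  have h2 : Tendsto (fun F : Finset ℕ =>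
      ‖∑ n ∈ F, S.projOp (B n) (hB n) ξ - S.projOp (⋃ n, B n) hU ξ‖ ^ 2) atTop (𝓝 0) := by
    have := (ENNReal.tendsto_toReal ENNReal.zero_ne_top).comp (h1.congr fun n => (hdist n).symm)
    simpa [Function.comp_def, ENNReal.toReal_ofReal, sq_nonneg] using this
  have h3 := h2.sqrt
  simp only [Real.sqrt_zero] at h3
  exact h3.congr fun n => Real.sqrt_sq (norm_nonneg _)

open Classical in
variable (S) in
/-- The image under `h` of the spectral measure of a calculus. -/
def spectral (h : α → ℝ) (hh : Measurable h) : SpectralMeasure H where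
  proj B := if hB : MeasurableSet B then S.projOp (h ⁻¹' B) (hh hB) else 0
  isStarProjection B hB := by rw [dif_pos hB]; exact isStarProjection_projOp _
  of_not_measurable B hB := dif_neg hB
  univ := by
    rw [dif_pos MeasurableSet.univ]
    ext ξ
    rw [projOp_apply]
    simpa [ind] using S.vec_one ξ
  inter B C hB hC := by
    rw [dif_pos hB, dif_pos hC, dif_pos (hB.inter hC)]
    exact projOp_inter (hh hB) (hh hC)
  hasSum B hB hd ξ := by
    have hU : MeasurableSet (⋃ n, B n) := .iUnion hB
    simp only [hB, hU, dif_pos]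
    have := hasSum_projOp (S := S) (fun n => hh (hB n)) (fun m n hmn => (hd hmn).preimage h) ξ
    simpa only [Set.preimage_iUnion] using this

theorem spectral_proj_apply {h : α → ℝ} (hh : Measurable h) {B : Set ℝ} (hB : MeasurableSet B)
    (ξ : H) : (S.spectral h hh).proj B ξ = S.vec (ind (h ⁻¹' B)) ξ := by
  rw [spectral]
  simp only [dif_pos hB]
  rfl

end Calculus

namespace SpectralMeasure

theorem scalar_apply (E : SpectralMeasure H) (ξ : H) {B : Set ℝ} (hB : MeasurableSet B) :
    E.scalar ξ B = ENNReal.ofReal (‖E.proj B ξ‖ ^ 2) :=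
  Measure.ofMeasurable_apply B hB

end SpectralMeasure

theorem Calculus.scalar_spectral {α : Type*} [MeasurableSpace α] {ι : Type*} [CommRing ι]
    [Algebra ℝ ι] (S : Calculus H α ι) {h : α → ℝ} (hh : Measurable h) (ξ : H) :
    (S.spectral h hh).scalar ξ = (S.meas ξ).map h := by
  ext B hB
  rw [SpectralMeasure.scalar_apply _ _ hB, Calculus.spectral_proj_apply hh hB,
    Calculus.sq_norm_vec_ind (hh hB), Measure.map_apply hh hB]

omit [CompleteSpace H] in
theorem ext_inner_right_self {T T' : H →L[ℂ] H}
    (h : ∀ ξ, inner ℂ ξ (T ξ) = inner ℂ ξ (T' ξ)) : T = T' := by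
  have : (T : H →ₗ[ℂ] H) = T' := (ext_inner_map _ _).1 fun ξ => by
    have := congrArg (starRingEnd ℂ) (h ξ)
    simpa [inner_conj_symm] using this
  exact ContinuousLinearMap.coe_injective this

omit [CompleteSpace H] in
/-- An operator on a dense domain is determined by its quadratic form. -/
theorem pmap_ext_of_inner {T T' : H →ₗ.[ℂ] H} (hd : Dense (T.domain : Set H))
    (hdom : T.domain = T'.domain)
    (h : ∀ ξ (hξ : ξ ∈ T.domain) (hξ' : ξ ∈ T'.domain),
      inner ℂ ξ (T ⟨ξ, hξ⟩) = inner ℂ ξ (T' ⟨ξ, hξ'⟩)) : T = T' := by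
  obtain ⟨D, A⟩ := T
  obtain ⟨D', A'⟩ := T'
  obtain rfl : D = D' := hdom
  congr 1
  have h0 : ∀ ξ : D, inner ℂ (ξ : H) ((A - A') ξ) = 0 := fun ξ => by
    have := h ξ ξ.2 ξ.2
    rw [LinearMap.sub_apply, inner_sub_right, sub_eq_zero]
    exact this
  have h1 : ∀ ξ η : D, inner ℂ (ξ : H) ((A - A') η) = 0 := by
    intro ξ η
    have e1 := h0 (ξ + η)
    have e2 := h0 (ξ + Complex.I • η)
    simp only [map_add, map_smul, Submodule.coe_add, Submodule.coe_smul, inner_add_left,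
      inner_add_right, inner_smul_left, inner_smul_right, h0, Complex.conj_I] at e1 e2
    have hI : Complex.I ≠ 0 := Complex.I_ne_zero
    have e3 : Complex.I * (inner ℂ (ξ : H) ((A - A') η) - inner ℂ (η : H) ((A - A') ξ)) = 0 := by
      linear_combination e2
    have e4 := (mul_eq_zero.1 e3).resolve_left hI
    linear_combination (e1 + e4) / 2
  rw [← sub_eq_zero]
  ext η
  refine hd.eq_zero_of_inner_left (𝕜 := ℂ) fun ξ hξ => ?_
  rw [← inner_conj_symm]
  exact (congrArg _ (h1 ⟨ξ, hξ⟩ η)).trans (map_zero _)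

/-! ### Simple-function calculus of a spectral measure and its integrals -/

namespace SpectralMeasure

variable (E : SpectralMeasure H)

instance (ξ : H) : IsFiniteMeasure (E.scalar ξ) :=
  ⟨by rw [E.scalar_apply ξ .univ]; exact ENNReal.ofReal_lt_top⟩

theorem inner_proj_eq {B : Set ℝ} (hB : MeasurableSet B) (ξ : H) :
    inner ℂ ξ (E.proj B ξ) = (((E.scalar ξ).real B : ℝ) : ℂ) := by
  have hp := E.isStarProjection B hB
  have h1 : E.proj B (E.proj B ξ) = E.proj B ξ :=
    congrArg (fun T : H →L[ℂ] H => T ξ) hp.isIdempotentElem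
  have h2 := ContinuousLinearMap.isSelfAdjoint_iff_isSymmetric.1 hp.isSelfAdjoint ξ (E.proj B ξ)
  simp only [ContinuousLinearMap.coe_coe] at h2
  rw [h1] at h2
  rw [← h2, inner_self_eq_norm_sq_to_K, measureReal_def, E.scalar_apply ξ hB,
    ENNReal.toReal_ofReal (sq_nonneg _)]
  simp

theorem proj_union {B C : Set ℝ} (hB : MeasurableSet B) (hC : MeasurableSet C)
    (hd : Disjoint B C) : E.proj (B ∪ C) = E.proj B + E.proj C := by
  refine ext_inner_right_self fun ξ => ?_
  rw [_root_.add_apply, inner_add_right, E.inner_proj_eq hB, E.inner_proj_eq hC,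
    E.inner_proj_eq (hB.union hC), measureReal_union hd hC]
  push_cast; rfl

theorem proj_empty : E.proj ∅ = 0 := by
  have := E.proj_union .empty .empty (disjoint_bot_left)
  simpa using this

/-- A spectral measure as a weight on real numbers. -/
def weight (B : Set ℝ) : ℝ →L[ℝ] (H →L[ℂ] H) :=
  ContinuousLinearMap.toSpanSingleton ℝ (E.proj B)

/-- The reference measure is 0, so every set has finite measure and every simple function is
integrable; no side conditions remain later. -/
theorem finMeasAdditive_weight : FinMeasAdditive (0 : Measure ℝ) E.weight := by
  intro B C hB hC _ _ hd
  ext : 1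
  simp [weight, E.proj_union hB hC hd]

/-- The integral of a simple function against a spectral measure. -/
def simpleOp : SimpleFunc ℝ ℝ →ₗ[ℝ] (H →L[ℂ] H) where
  toFun f := f.setToSimpleFunc E.weight
  map_add' _ _ := SimpleFunc.setToSimpleFunc_add _ E.finMeasAdditive_weight
    integrable_zero_measure integrable_zero_measure
  map_smul' c _ := SimpleFunc.setToSimpleFunc_smul_real _ E.finMeasAdditive_weight c
    integrable_zero_measure

/-- The simple function with value `c` on `B` and `0` elsewhere. -/
abbrev simpleInd (c : ℝ) {B : Set ℝ} (hB : MeasurableSet B) : SimpleFunc ℝ ℝ :=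
  .piecewise B hB (.const ℝ c) (.const ℝ 0)

theorem simpleOp_simpleInd (c : ℝ) {B : Set ℝ} (hB : MeasurableSet B) :
    E.simpleOp (simpleInd c hB) = c • E.proj B := by
  refine (SimpleFunc.setToSimpleFunc_indicator E.weight ?_ hB c).trans rfl
  simp [weight, proj_empty]

theorem simpleOp_mul (f g : SimpleFunc ℝ ℝ) :
    E.simpleOp (f * g) = E.simpleOp f * E.simpleOp g := by
  induction f using SimpleFunc.induction with
  | @const c B hB =>
    induction g using SimpleFunc.induction with
    | @const d C hC =>
      have h : (simpleInd c hB * simpleInd d hC) = simpleInd (c * d) (hB.inter hC) := by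
        ext a
        by_cases h1 : a ∈ B <;> by_cases h2 : a ∈ C <;>
          simp [SimpleFunc.piecewise_apply, h1, h2]
      rw [h, simpleOp_simpleInd, simpleOp_simpleInd, simpleOp_simpleInd, E.inter _ _ hB hC,
        smul_mul_smul_comm]
    | add _ h1 h2 => rw [mul_add, map_add, map_add, mul_add, h1, h2]
  | add _ h1 h2 => rw [add_mul, map_add, map_add, add_mul, h1, h2]

theorem isSelfAdjoint_simpleOp (f : SimpleFunc ℝ ℝ) : IsSelfAdjoint (E.simpleOp f) := by
  induction f using SimpleFunc.induction with
  | const c hB =>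
    rw [simpleOp_simpleInd]
    have h := ContinuousLinearMap.isSelfAdjoint_iff_isSymmetric.1
      (E.isStarProjection _ hB).isSelfAdjoint
    refine ContinuousLinearMap.isSelfAdjoint_iff_isSymmetric.2 fun ξ η => ?_
    have h' := h ξ η
    simp only [ContinuousLinearMap.coe_coe, _root_.smul_apply] at h' ⊢
    rw [← Complex.coe_smul, ← Complex.coe_smul, inner_smul_left, inner_smul_right,
      Complex.conj_ofReal, h']
  | add _ h1 h2 => rw [map_add]; exact h1.add h2

theorem integrable_simpleFunc (f : SimpleFunc ℝ ℝ) (μ : Measure ℝ) [IsFiniteMeasure μ] :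
    Integrable f μ := f.integrable_of_isFiniteMeasure

theorem inner_simpleOp (f : SimpleFunc ℝ ℝ) (ξ : H) :
    inner ℂ ξ (E.simpleOp f ξ) = ((∫ a, f a ∂(E.scalar ξ) : ℝ) : ℂ) := by
  induction f using SimpleFunc.induction with
  | @const c B hB =>
    have h : ∫ a, simpleInd c hB a ∂(E.scalar ξ) = (E.scalar ξ).real B * c := by
      rw [← smul_eq_mul, ← integral_indicator_const c hB]
      refine integral_congr_ae (ae_of_all _ fun a => ?_)
      by_cases h : a ∈ B <;> simp [SimpleFunc.piecewise_apply, h]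
    rw [h, simpleOp_simpleInd, _root_.smul_apply, ← Complex.coe_smul,
      inner_smul_right, E.inner_proj_eq hB]
    push_cast; ring
  | @add f g _ h1 h2 =>
    rw [map_add, _root_.add_apply, inner_add_right, h1, h2, ← Complex.ofReal_add,
      ← integral_add (integrable_simpleFunc f _) (integrable_simpleFunc g _)]
    rfl

/-- The calculus of simple functions with respect to a spectral measure. -/
def calculus : Calculus H ℝ (SimpleFunc ℝ ℝ) where
  fn := { toFun := fun f => f, map_one' := rfl, map_mul' := fun _ _ => rfl, map_zero' := rfl,
          map_add' := fun _ _ => rfl, commutes' := fun _ => rfl }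
  op := AlgHom.ofLinearMap E.simpleOp (by
    have h : (1 : SimpleFunc ℝ ℝ) = simpleInd 1 .univ := by ext a; simp
    rw [h, simpleOp_simpleInd, E.univ, one_smul]) E.simpleOp_mul
  meas := E.scalar
  finite := inferInstance
  measurable f := f.measurable
  bounded f := by
    obtain ⟨C, hC⟩ := f.exists_forall_norm_le
    exact ⟨C, hC⟩
  isSelfAdjoint := E.isSelfAdjoint_simpleOp
  inner_op := E.inner_simpleOp
  dense μ _ f hf ε hε := by
    obtain ⟨g, hg, -⟩ := hf.exists_simpleFunc_eLpNorm_sub_lt (by norm_num) hε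
    exact ⟨g, hg.le⟩

theorem calculus_meas (ξ : H) : E.calculus.meas ξ = E.scalar ξ := rfl

theorem vec_ind_eq_proj {B : Set ℝ} (hB : MeasurableSet B) (ξ : H) :
    E.calculus.vec (Calculus.ind B) ξ = E.proj B ξ := by
  have h := E.calculus.vec_fn (simpleInd 1 hB) ξ
  have h1 : E.calculus.fn (simpleInd 1 hB) = Calculus.ind B := by
    ext a
    change simpleInd 1 hB a = _
    by_cases h : a ∈ B <;> simp [SimpleFunc.piecewise_apply, h]
  have h2 : E.calculus.op (simpleInd 1 hB) = E.proj B := by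
    change E.simpleOp _ = _
    rw [simpleOp_simpleInd, one_smul]
  rwa [h1, h2] at h

variable {E} {f : ℝ → ℝ} (hf : Measurable f)
include hf

theorem isIntegral_pmap : E.IsIntegral f (E.calculus.pmap f hf) :=
  ⟨fun _ => memLp_two_iff_lintegral hf, fun ξ => E.calculus.inner_self_vec ξ.2⟩

theorem IsIntegral.eq_pmap {T : H →ₗ.[ℂ] H} (hT : E.IsIntegral f T) :
    T = E.calculus.pmap f hf := by
  have hdom : T.domain = (E.calculus.pmap f hf).domain := by
    ext ξ
    rw [hT.1, (isIntegral_pmap hf).1]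
  refine pmap_ext_of_inner (hdom ▸ E.calculus.dense_pmap_domain hf) hdom fun ξ h h' => ?_
  exact (hT.2 ⟨ξ, h⟩).trans ((isIntegral_pmap hf).2 ⟨ξ, h'⟩).symm

theorem integral_eq_pmap : E.integral f = E.calculus.pmap f hf := by
  have h : ∃ T, E.IsIntegral f T := ⟨_, isIntegral_pmap hf⟩
  rw [integral, dif_pos h]
  exact IsIntegral.eq_pmap hf h.choose_spec

end SpectralMeasure

/-! ### Uniqueness of the spectral measure -/

/-- A bounded injective continuous function which equals `(1 + s)⁻¹` for `s ≥ 0`. -/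
def resolventFun (s : ℝ) : ℝ := 1 - s / (1 + |s|)

theorem continuous_resolventFun : Continuous resolventFun := by
  unfold resolventFun
  refine continuous_const.sub (continuous_id.div (by fun_prop) fun s => ?_)
  positivity

theorem abs_resolventFun_le (s : ℝ) : |resolventFun s| ≤ 2 := by
  have h : |s / (1 + |s|)| ≤ 1 := by
    rw [abs_div, abs_of_pos (by positivity : 0 < 1 + |s|), div_le_one (by positivity)]
    linarith
  unfold resolventFun
  rw [abs_le] at h ⊢
  constructor <;> linarith

theorem resolventFun_injective : Function.Injective resolventFun := by
  intro s t h
  unfold resolventFun at h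
  have hs : 0 < 1 + |s| := by positivity
  have ht : 0 < 1 + |t| := by positivity
  have h1 : s / (1 + |s|) = t / (1 + |t|) := by linarith
  rw [div_eq_div_iff hs.ne' ht.ne'] at h1
  rcases abs_cases s with ⟨e, _⟩ | ⟨e, _⟩ <;> rcases abs_cases t with ⟨e', _⟩ | ⟨e', _⟩ <;>
    rw [e, e'] at h1 <;> nlinarith

theorem id_mul_resolventFun {s : ℝ} (hs : 0 ≤ s) : s * resolventFun s = 1 - resolventFun s := by
  unfold resolventFun
  rw [abs_of_nonneg hs]
  field_simp
  ring

omit [CompleteSpace H] in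
theorem norm_le_norm_add_apply {A : H →ₗ.[ℂ] H}
    (hpos : ∀ ξ : A.domain, 0 ≤ RCLike.re (inner ℂ (ξ : H) (A ξ))) (ξ : A.domain) :
    ‖(ξ : H)‖ ≤ ‖(ξ : H) + A ξ‖ ∧ ‖A ξ‖ ≤ ‖(ξ : H) + A ξ‖ := by
  have h := norm_add_sq (𝕜 := ℂ) (ξ : H) (A ξ)
  have h1 := hpos ξ
  constructor <;> refine (sq_le_sq₀ (norm_nonneg _) (norm_nonneg _)).1 ?_ <;>
    nlinarith [sq_nonneg ‖A ξ‖, sq_nonneg ‖(ξ : H)‖]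

omit [CompleteSpace H] in
theorem eq_of_add_apply_eq {A : H →ₗ.[ℂ] H}
    (hpos : ∀ ξ : A.domain, 0 ≤ RCLike.re (inner ℂ (ξ : H) (A ξ))) {ξ η : A.domain}
    (h : (ξ : H) + A ξ = η + A η) : (ξ : H) = η := by
  have h1 := (norm_le_norm_add_apply hpos (ξ - η)).1
  have h2 : ((ξ - η : A.domain) : H) + A (ξ - η) = 0 := by
    rw [LinearPMap.map_sub, Submodule.coe_sub, ← sub_eq_zero.2 h]
    abel
  rw [h2, norm_zero] at h1
  simpa [sub_eq_zero] using norm_le_zero_iff.1 h1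

namespace SpectralMeasure

variable {E E' : SpectralMeasure H} {A : H →ₗ.[ℂ] H}

theorem ext_of_scalar (h : ∀ ξ, E.scalar ξ = E'.scalar ξ) : E = E' := by
  have hp : E.proj = E'.proj := by
    ext1 B
    by_cases hB : MeasurableSet B
    · refine ext_inner_right_self fun ξ => ?_
      rw [E.inner_proj_eq hB, E'.inner_proj_eq hB, h]
    · rw [E.of_not_measurable B hB, E'.of_not_measurable B hB]
  obtain ⟨_, _, _, _, _, _⟩ := E
  obtain ⟨_, _, _, _, _, _⟩ := E'
  subst hp
  rfl

/-- Positivity is tested on E(B)ξ with B a bounded piece of the negative half-line: ∫_B s dμ_ξ is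
nonnegative while its integrand is negative on B, so B is null. -/
theorem IsIntegral.ae_nonneg (hE : E.IsIntegral (fun s => s) A)
    (hpos : ∀ ξ : A.domain, 0 ≤ RCLike.re (inner ℂ (ξ : H) (A ξ))) (ξ : H) :
    ∀ᵐ s ∂(E.scalar ξ), 0 ≤ s := by
  have hid : Measurable fun s : ℝ => s := measurable_id
  obtain rfl := hE.eq_pmap hid
  have hn : ∀ n : ℕ, E.scalar ξ {s : ℝ | s < 0 ∧ |s| ≤ n} = 0 := by
    intro n
    set B : Set ℝ := {s : ℝ | s < 0 ∧ |s| ≤ n} with hBdef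
    have hB : MeasurableSet B :=
      (measurableSet_lt measurable_id measurable_const).inter
        (measurableSet_le measurable_id.abs measurable_const)
    have hm : MemLp (B.indicator fun s : ℝ => s) 2 (E.calculus.meas ξ) :=
      Calculus.memLp_indicator_of_bounded hid hB (C := n) (fun _ h => h.2) _
    have h1 := hpos ⟨E.calculus.vec (Calculus.ind B) ξ,
      (Calculus.memLp_vec_ind_iff hB hid).2 hm⟩
    rw [Calculus.pmap_apply] at h1
    dsimp only at h1
    rw [Calculus.vec_vec_ind hB hid hm,
      Calculus.inner_vec_vec _ (Calculus.memLp_ind hB _) hm] at h1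
    have h2 : (fun a => Calculus.ind B a * B.indicator (fun s : ℝ => s) a) =
        B.indicator fun s : ℝ => s := by
      ext a; by_cases h : a ∈ B <;> simp [h]
    rw [h2] at h1
    have h3 : 0 ≤ ∫ a, B.indicator (fun s : ℝ => s) a ∂(E.calculus.meas ξ) := by simpa using h1
    have h4 : ∫ a, -B.indicator (fun s : ℝ => s) a ∂(E.calculus.meas ξ) = 0 := by
      rw [integral_neg]
      have : ∫ a, B.indicator (fun s : ℝ => s) a ∂(E.calculus.meas ξ) ≤ 0 :=
        integral_nonpos fun a => by
          by_cases h : a ∈ B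
          · simpa [h] using h.1.le
          · simp [h]
      linarith
    have h5 := (integral_eq_zero_iff_of_nonneg (fun a => by
      by_cases h : a ∈ B
      · simpa [h] using h.1.le
      · simp [h]) (hm.integrable (by norm_num)).neg).1 h4
    rw [← calculus_meas]
    refine measure_mono_null (fun a ha => ?_) h5
    have : a < 0 := ha.1
    simp [ha, this.ne]
  have hU : {s : ℝ | ¬ 0 ≤ s} ⊆ ⋃ n : ℕ, {s : ℝ | s < 0 ∧ |s| ≤ n} := fun s hs => by
    obtain ⟨n, hn⟩ := exists_nat_ge |s|
    exact Set.mem_iUnion.2 ⟨n, not_le.1 hs, hn⟩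
  exact measure_mono_null hU (measure_iUnion_null hn)

/-- Almost everywhere s · r(s) = 1 − r(s) for r = `resolventFun`, so r(S)ξ solves η + Aη = ξ. By
`eq_of_add_apply_eq` that solution depends on A only, not on E. -/
theorem IsIntegral.add_apply_resolvent (hE : E.IsIntegral (fun s => s) A)
    (hpos : ∀ ξ : A.domain, 0 ≤ RCLike.re (inner ℂ (ξ : H) (A ξ))) (ξ : H) :
    ∃ h : E.calculus.vec resolventFun ξ ∈ A.domain,
      E.calculus.vec resolventFun ξ + A ⟨_, h⟩ = ξ := by
  have hae := hE.ae_nonneg hpos ξ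
  have hid : Measurable fun s : ℝ => s := measurable_id
  obtain rfl := hE.eq_pmap hid
  have hr := continuous_resolventFun.measurable
  have hm : MemLp resolventFun 2 (E.calculus.meas ξ) :=
    MemLp.of_bound hr.aestronglyMeasurable 2 (ae_of_all _ abs_resolventFun_le)
  have h1 : MemLp (1 : ℝ → ℝ) 2 (E.calculus.meas ξ) := memLp_const 1
  have hae' : (fun s : ℝ => s) * resolventFun =ᵐ[E.calculus.meas ξ] 1 - resolventFun :=
    hae.mono fun s hs => id_mul_resolventFun hs
  have hmm : MemLp ((fun s : ℝ => s) * resolventFun) 2 (E.calculus.meas ξ) :=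
    (memLp_congr_ae hae').2 (h1.sub hm)
  refine ⟨(Calculus.memLp_vec_iff _ hid hr hm).2 hmm, ?_⟩
  rw [Calculus.pmap_apply]
  dsimp only
  rw [Calculus.vec_vec _ hid hr hm hmm, Calculus.vec_congr _ hae', Calculus.vec_sub_fun _ h1 hm,
    Calculus.vec_one]
  abel

/-- The bounded continuous functions at which two calculi agree. -/
def agreeSubalgebra (E E' : SpectralMeasure H) :
    StarSubalgebra ℝ (BoundedContinuousFunction ℝ ℝ) where
  carrier := {g | ∀ ξ, E.calculus.vec g ξ = E'.calculus.vec g ξ}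
  mul_mem' := by
    intro f g hf hg ξ
    have hm : ∀ (g : BoundedContinuousFunction ℝ ℝ) (μ : Measure ℝ) [IsFiniteMeasure μ],
        MemLp g 2 μ := fun g μ _ => MemLp.of_bound g.continuous.aestronglyMeasurable ‖g‖
      (ae_of_all _ g.norm_coe_le_norm)
    have hc : ⇑(f * g) = ⇑f * ⇑g := rfl
    rw [hc, ← E.calculus.vec_vec f.continuous.measurable g.continuous.measurable (hm g _)
      (hm (f * g) _), ← E'.calculus.vec_vec f.continuous.measurable g.continuous.measurable (hm g _)
      (hm (f * g) _), hg, hf]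
  add_mem' := by
    intro f g hf hg ξ
    have hm : ∀ (g : BoundedContinuousFunction ℝ ℝ) (μ : Measure ℝ) [IsFiniteMeasure μ],
        MemLp g 2 μ := fun g μ _ => MemLp.of_bound g.continuous.aestronglyMeasurable ‖g‖
      (ae_of_all _ g.norm_coe_le_norm)
    have hc : ⇑(f + g) = ⇑f + ⇑g := rfl
    rw [hc, E.calculus.vec_add_fun (hm f _) (hm g _), E'.calculus.vec_add_fun (hm f _) (hm g _), hf,
      hg]
  algebraMap_mem' := by
    intro c ξ
    have hc : ⇑(algebraMap ℝ (BoundedContinuousFunction ℝ ℝ) c) = c • (1 : ℝ → ℝ) := by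
      ext a; simp
    have h1 : ∀ (μ : Measure ℝ) [IsFiniteMeasure μ], MemLp (1 : ℝ → ℝ) 2 μ :=
      fun μ _ => memLp_const 1
    rw [hc, E.calculus.vec_smul_fun (h1 _), E'.calculus.vec_smul_fun (h1 _), Calculus.vec_one,
      Calculus.vec_one]
  star_mem' := by
    intro f hf ξ
    have hc : ⇑(star f) = ⇑f := by ext a; simp
    rw [hc, hf]

/-- A positive operator has at most one spectral measure. -/
theorem IsIntegral.unique (hE : E.IsIntegral (fun s => s) A) (hE' : E'.IsIntegral (fun s => s) A)
    (hpos : ∀ ξ : A.domain, 0 ≤ RCLike.re (inner ℂ (ξ : H) (A ξ))) : E = E' := by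
  refine ext_of_scalar fun ξ => ?_
  refine ext_of_forall_mem_subalgebra_integral_eq_of_pseudoEMetric_complete_countable (𝕜 := ℝ)
    (A := agreeSubalgebra E E') ?_ ?_
  -- Both calculi send `resolventFun` to (1 + A)⁻¹, so it lies in the subalgebra; being injective,
  -- it separates points by itself.
  · intro s t hst
    let r : BoundedContinuousFunction ℝ ℝ :=
      BoundedContinuousFunction.ofNormedAddCommGroup resolventFun continuous_resolventFun 2
        abs_resolventFun_le
    have hr : r ∈ agreeSubalgebra E E' := by
      intro ξ
      obtain ⟨h1, h2⟩ := hE.add_apply_resolvent hpos ξ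
      obtain ⟨h3, h4⟩ := hE'.add_apply_resolvent hpos ξ
      exact eq_of_add_apply_eq hpos (ξ := ⟨_, h1⟩) (η := ⟨_, h3⟩) (h2.trans h4.symm)
    refine ⟨r, ⟨BoundedContinuousFunction.toContinuousMapStarₐ ℝ r, ⟨r, hr, rfl⟩, rfl⟩, ?_⟩
    exact fun h => hst (resolventFun_injective h)
  · intro g hg
    have hm : ∀ (μ : Measure ℝ) [IsFiniteMeasure μ],
        MemLp g 2 μ := fun μ _ => MemLp.of_bound g.continuous.aestronglyMeasurable ‖g‖
      (ae_of_all _ g.norm_coe_le_norm)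
    have h := E.calculus.inner_self_vec (hm (E.calculus.meas ξ))
    rw [hg ξ, E'.calculus.inner_self_vec (hm _)] at h
    exact (Complex.ofReal_injective h).symm

theorem IsIntegral.spectralMeasure_eq (hE : E.IsIntegral (fun s => s) A)
    (hpos : ∀ ξ : A.domain, 0 ≤ RCLike.re (inner ℂ (ξ : H) (A ξ))) : spectralMeasure A = E := by
  have h : ∃ E : SpectralMeasure H, E.IsIntegral (fun s => s) A := ⟨E, hE⟩
  rw [spectralMeasure, dif_pos h]
  exact h.choose_spec.unique hE hpos

end SpectralMeasure

/-! ### Existence of the spectral measure -/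

section BoundedCalculus

variable {R : H →L[ℂ] H} (hR : IsSelfAdjoint R)

theorem isSelfAdjoint_cfcHom (f : C(spectrum ℝ R, ℝ)) : IsSelfAdjoint (cfcHom hR f) := by
  rw [IsSelfAdjoint, ← map_star]
  congr 1

/-- The positive functional `f ↦ ⟨ξ, f(R) ξ⟩`. -/
def quadraticFunctional (ξ : H) : CompactlySupportedContinuousMap (spectrum ℝ R) ℝ →ₚ[ℝ] ℝ :=
  PositiveLinearMap.mk₀
    { toFun := fun f => RCLike.re (inner ℂ ξ (cfcHom hR (f : C(spectrum ℝ R, ℝ)) ξ))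
      map_add' := fun f g => by
        have : ((f + g : CompactlySupportedContinuousMap _ ℝ) : C(spectrum ℝ R, ℝ)) =
          (f : C(spectrum ℝ R, ℝ)) + g := rfl
        rw [this, map_add, _root_.add_apply, inner_add_right, map_add]
      map_smul' := fun c f => by
        have : ((c • f : CompactlySupportedContinuousMap _ ℝ) : C(spectrum ℝ R, ℝ)) =
          c • (f : C(spectrum ℝ R, ℝ)) := rfl
        rw [this, map_smul, _root_.smul_apply, ← Complex.coe_smul, inner_smul_right]
        simp }
    fun f hf => by
      have h : 0 ≤ cfcHom hR (f : C(spectrum ℝ R, ℝ)) := (cfcHom_nonneg_iff hR).2 hf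
      exact ((ContinuousLinearMap.nonneg_iff_isPositive _).1 h).re_inner_nonneg_right ξ

/-- The scalar spectral measures of a bounded self-adjoint operator. -/
def boundedMeas (ξ : H) : Measure (spectrum ℝ R) := RealRMK.rieszMeasure (quadraticFunctional hR ξ)

/-- The Riesz measure represents the real part only; self-adjointness of f(R) removes the imaginary
part. -/
theorem inner_cfcHom (f : C(spectrum ℝ R, ℝ)) (ξ : H) :
    inner ℂ ξ (cfcHom hR f ξ) = ((∫ a, f a ∂(boundedMeas hR ξ) : ℝ) : ℂ) := by
  have h := RealRMK.integral_rieszMeasure (quadraticFunctional hR ξ)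
    (CompactlySupportedContinuousMap.continuousMapEquiv f)
  have h1 : ∫ a, f a ∂(boundedMeas hR ξ) = RCLike.re (inner ℂ ξ (cfcHom hR f ξ)) := h
  rw [h1]
  have hs := ContinuousLinearMap.isSelfAdjoint_iff_isSymmetric.1 (isSelfAdjoint_cfcHom hR f)
  have h2 : starRingEnd ℂ (inner ℂ ξ (cfcHom hR f ξ)) = inner ℂ ξ (cfcHom hR f ξ) := by
    rw [inner_conj_symm]
    exact hs ξ ξ
  exact (Complex.conj_eq_iff_re.1 h2).symm

/-- The continuous functional calculus of a bounded self-adjoint operator. -/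
def boundedCalculus : Calculus H (spectrum ℝ R) C(spectrum ℝ R, ℝ) where
  fn := ContinuousMap.coeFnAlgHom ℝ
  op := (cfcHom hR : C(spectrum ℝ R, ℝ) →⋆ₐ[ℝ] (H →L[ℂ] H)).toAlgHom
  meas := boundedMeas hR
  finite ξ := by unfold boundedMeas; infer_instance
  measurable f := f.continuous.measurable
  bounded f := ⟨‖f‖, f.norm_coe_le_norm⟩
  isSelfAdjoint := isSelfAdjoint_cfcHom hR
  inner_op := inner_cfcHom hR
  dense μ _ f hf ε hε := by
    obtain ⟨g, hg, -⟩ := hf.exists_boundedContinuous_eLpNorm_sub_le (by norm_num) hε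
    exact ⟨g, hg⟩

/-- The coordinate function on the spectrum of `R`. -/
def specVal (a : spectrum ℝ R) : ℝ := a

theorem boundedCalculus_vec_specVal (ξ : H) : (boundedCalculus hR).vec specVal ξ = R ξ := by
  have h := (boundedCalculus hR).vec_fn (.restrict (spectrum ℝ R) (.id ℝ)) ξ
  have h2 : (boundedCalculus hR).op (.restrict (spectrum ℝ R) (.id ℝ)) = R := cfcHom_id hR
  rw [h2] at h
  exact h

end BoundedCalculus

section Resolvent

variable {A : H →ₗ.[ℂ] H}

/-- The bounded inverse of `1 + A`. -/
theorem exists_resolvent (hA : IsPositiveSelfAdjoint A) :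
    ∃ R : H →L[ℂ] H, IsSelfAdjoint R ∧ (∀ ξ, ∃ h : R ξ ∈ A.domain, R ξ + A ⟨R ξ, h⟩ = ξ) ∧
      ∀ ξ : A.domain, R (ξ + A ξ) = ξ := by
  obtain ⟨hd, hsa, hpos⟩ := hA
  have hsymm : ∀ ξ η : A.domain, inner ℂ (A ξ) (η : H) = inner ℂ (ξ : H) (A η) := by
    have h := LinearPMap.adjoint_isFormalAdjoint hd
    rw [LinearPMap.isSelfAdjoint_def.1 hsa] at h
    exact h
  have hcl : IsClosed (A.graph : Set (H × H)) := hsa.isClosed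
  have : CompleteSpace A.graph := hcl.completeSpace_coe
  let L : A.graph →L[ℂ] H :=
    (ContinuousLinearMap.fst ℂ H H + ContinuousLinearMap.snd ℂ H H).comp A.graph.subtypeL
  -- Positivity gives ‖ξ‖, ‖Aξ‖ ≤ ‖ξ + Aξ‖. As the product norm is a maximum, the map (ξ, Aξ) ↦ ξ +
  -- Aξ is bounded below on the closed graph, hence injective with closed range.
  have hL : ∀ p : A.graph, ‖p‖ ≤ (1 : ℝ≥0) * ‖L p‖ := by
    rintro ⟨⟨ξ, η⟩, hp⟩
    obtain ⟨ζ, rfl, rfl⟩ := (LinearPMap.mem_graph_iff _).1 hp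
    have h := norm_le_norm_add_apply hpos ζ
    rw [NNReal.coe_one, one_mul]
    exact max_le h.1 h.2
  have hanti := ContinuousLinearMap.antilipschitz_of_bound L hL
  have hker : (L : A.graph →ₗ[ℂ] H).ker = ⊥ := LinearMap.ker_eq_bot.2 hanti.injective
  have hrange : (L : A.graph →ₗ[ℂ] H).range = ⊤ := by
    have hc : IsClosed ((L : A.graph →ₗ[ℂ] H).range : Set H) := by
      rw [LinearMap.coe_range]
      exact hanti.isClosed_range L.uniformContinuous
    have : CompleteSpace (L : A.graph →ₗ[ℂ] H).range := hc.completeSpace_coe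
    -- A vector ζ orthogonal to the range satisfies A*ζ = −ζ. Since A* = A, this means ζ + Aζ = 0,
    -- and the lower bound forces ζ = 0.
    rw [← Submodule.orthogonal_eq_bot_iff, Submodule.eq_bot_iff]
    intro ζ hζ
    have h0 : ∀ η : A.domain, inner ℂ (-ζ) (η : H) = inner ℂ ζ (A η) := by
      intro η
      have h1 : (η : H) + A η ∈ (L : A.graph →ₗ[ℂ] H).range :=
        ⟨⟨(η, A η), A.mem_graph η⟩, rfl⟩
      have h2 := Submodule.inner_left_of_mem_orthogonal h1 hζ
      rw [inner_add_right] at h2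
      rw [inner_neg_left]
      linear_combination -h2
    have hmem : ζ ∈ A.adjoint.domain := LinearPMap.mem_adjoint_domain_of_exists ζ ⟨-ζ, h0⟩
    have hap : A.adjoint ⟨ζ, hmem⟩ = -ζ := LinearPMap.adjoint_apply_eq hd ⟨ζ, hmem⟩ h0
    -- The argument of the adjoint carries a domain-membership proof, so A* = A is used by
    -- generalizing over T.
    have key : ∀ T : H →ₗ.[ℂ] H, T = A → ∀ h : ζ ∈ T.domain, T ⟨ζ, h⟩ = -ζ →
        ∃ h : ζ ∈ A.domain, A ⟨ζ, h⟩ = -ζ := by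
      rintro T rfl h h'
      exact ⟨h, h'⟩
    obtain ⟨h, h'⟩ := key _ (LinearPMap.isSelfAdjoint_def.1 hsa) hmem hap
    have := (norm_le_norm_add_apply hpos ⟨ζ, h⟩).1
    rw [h'] at this
    simpa using this
  let e := ContinuousLinearEquiv.ofBijective L hker hrange
  let R : H →L[ℂ] H := ((ContinuousLinearMap.fst ℂ H H).comp A.graph.subtypeL).comp
    (e.symm : H →L[ℂ] A.graph)
  have h1 : ∀ ξ, ∃ h : R ξ ∈ A.domain, R ξ + A ⟨R ξ, h⟩ = ξ := by
    intro ξ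
    have hp := (e.symm ξ).2
    obtain ⟨ζ, hζ1, hζ2⟩ := (LinearPMap.mem_graph_iff _).1 hp
    have hRζ : R ξ = ζ := hζ1.symm
    have hs : e (e.symm ξ) = ξ := e.apply_symm_apply ξ
    have hs' : ((e.symm ξ : A.graph) : H × H).1 + ((e.symm ξ : A.graph) : H × H).2 = ξ := hs
    have hmem : R ξ ∈ A.domain := hRζ ▸ ζ.2
    refine ⟨hmem, ?_⟩
    have : (⟨R ξ, hmem⟩ : A.domain) = ζ := Subtype.ext hRζ
    rw [this, hζ2]
    exact hs'
  have h2 : ∀ ξ : A.domain, R (ξ + A ξ) = ξ := by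
    intro ξ
    obtain ⟨h, h'⟩ := h1 (ξ + A ξ)
    exact eq_of_add_apply_eq hpos (ξ := ⟨_, h⟩) h'
  refine ⟨R, ContinuousLinearMap.isSelfAdjoint_iff_isSymmetric.2 fun ξ η => ?_, h1, h2⟩
  obtain ⟨hξ, hξ'⟩ := h1 ξ
  obtain ⟨hη, hη'⟩ := h1 η
  have h3 := hsymm ⟨_, hξ⟩ ⟨_, hη⟩
  calc inner ℂ (R ξ) η = inner ℂ (R ξ) (R η + A ⟨_, hη⟩) := by rw [hη']
    _ = inner ℂ (R ξ + A ⟨_, hξ⟩) (R η) := by rw [inner_add_left, inner_add_right, h3]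
    _ = inner ℂ ξ (R η) := by rw [hξ']

/-- The spectral theorem for positive self-adjoint operators. -/
theorem exists_isIntegral (hA : IsPositiveSelfAdjoint A) :
    ∃ E : SpectralMeasure H, E.IsIntegral (fun s => s) A := by
  obtain ⟨R, hR, h1, h2⟩ := exists_resolvent hA
  set S := boundedCalculus hR with hS
  have hv : Measurable (specVal : spectrum ℝ R → ℝ) := measurable_subtype_coe
  -- Since R = (1 + A)⁻¹, a spectral value v of R corresponds to the value v⁻¹ − 1 of A. At v = 0
  -- this is a junk value, excluded almost everywhere by injectivity of R (`hne`).
  let h : spectrum ℝ R → ℝ := fun a => (specVal a)⁻¹ - 1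
  have hh : Measurable h := hv.inv.sub_const 1
  have hRinj : ∀ ξ, R ξ = 0 → ξ = 0 := by
    intro ξ hξ
    obtain ⟨hm, he⟩ := h1 ξ
    have : (⟨R ξ, hm⟩ : A.domain) = 0 := Subtype.ext hξ
    rw [this, LinearPMap.map_zero, hξ, add_zero] at he
    exact he.symm
  have hvm : ∀ ξ, MemLp specVal 2 (S.meas ξ) := fun ξ =>
    S.memLp_fn (.restrict (spectrum ℝ R) (.id ℝ)) 2 _
  have hvec : ∀ ξ, S.vec specVal ξ = R ξ := boundedCalculus_vec_specVal hR
  have hne : ∀ ξ, ∀ᵐ a ∂(S.meas ξ), specVal a ≠ 0 := by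
    intro ξ
    set B : Set (spectrum ℝ R) := {a | specVal a = 0}
    have hB : MeasurableSet B := hv (measurableSet_singleton 0)
    have h0 : B.indicator (specVal : spectrum ℝ R → ℝ) = S.fn 0 := by
      rw [map_zero]
      ext a
      by_cases ha : a ∈ B
      · have : specVal a = 0 := ha
        simp [this]
      · simp [ha]
    have h3 : S.vec (Calculus.ind B) ξ = 0 := by
      apply hRinj
      rw [← hvec, Calculus.vec_vec_ind hB hv ((hvm ξ).indicator hB), h0, S.vec_fn, map_zero]
      rfl
    have h4 := Calculus.sq_norm_vec_ind (S := S) hB ξ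
    rw [h3] at h4
    have h5 : S.meas ξ B = 0 := by simpa using h4.symm
    simpa [ae_iff] using h5
  have hone : ∀ ξ, MemLp (1 : spectrum ℝ R → ℝ) 2 (S.meas ξ) := fun ξ => memLp_const 1
  have hdom : ∀ ξ : A.domain, MemLp h 2 (S.meas (ξ : H)) ∧ S.vec h ξ = A ξ := by
    intro ξ
    set ζ := (ξ : H) + A ξ with hζ
    have hξ : (ξ : H) = S.vec specVal ζ := by rw [hvec, h2]
    have hae : h * specVal =ᵐ[S.meas ζ] 1 - specVal := (hne ζ).mono fun a ha => by
      simp only [h, Pi.mul_apply, Pi.sub_apply, Pi.one_apply]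
      field_simp
    have hm : MemLp (h * specVal) 2 (S.meas ζ) := (memLp_congr_ae hae).2 ((hone ζ).sub (hvm ζ))
    rw [hξ]
    refine ⟨(S.memLp_vec_iff hh hv (hvm ζ)).2 hm, ?_⟩
    rw [S.vec_vec hh hv (hvm ζ) hm, S.vec_congr hae, S.vec_sub_fun (hone ζ) (hvm ζ), S.vec_one,
      ← hξ, hζ]
    abel
  -- Conversely, ξ = R((1 + h)(S)ξ) lies in the range of R, which is contained in the domain of A.
  have hconv : ∀ ξ, MemLp h 2 (S.meas ξ) → ξ ∈ A.domain := by
    intro ξ hξ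
    have hm : MemLp (1 + h) 2 (S.meas ξ) := (hone ξ).add hξ
    have hae : specVal * (1 + h) =ᵐ[S.meas ξ] 1 := (hne ξ).mono fun a ha => by
      simp only [h, Pi.mul_apply, Pi.add_apply, Pi.one_apply]
      field_simp
      ring
    have h3 : R (S.vec (1 + h) ξ) = ξ := by
      rw [← hvec, S.vec_vec hv (measurable_one.add hh) hm ((memLp_congr_ae hae).2 (hone ξ)),
        S.vec_congr hae, S.vec_one]
    obtain ⟨h4, -⟩ := h1 (S.vec (1 + h) ξ)
    rwa [h3] at h4
  refine ⟨S.spectral h hh, fun ξ => ?_, fun ξ => ?_⟩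
  · rw [S.scalar_spectral hh, lintegral_map (by fun_prop) hh, ← memLp_two_iff_lintegral hh]
    exact ⟨fun hξ => (hdom ⟨ξ, hξ⟩).1, hconv ξ⟩
  · rw [S.scalar_spectral hh, integral_map hh.aemeasurable (f := fun s : ℝ => s)
      measurable_id.aestronglyMeasurable, ← S.inner_self_vec (hdom ξ).1, (hdom ξ).2]

theorem isIntegral_spectralMeasure (hA : IsPositiveSelfAdjoint A) :
    (spectralMeasure A).IsIntegral (fun s => s) A := by
  have h := exists_isIntegral hA
  rw [spectralMeasure, dif_pos h]
  exact h.choose_spec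

end Resolvent

/-! ### Orlicz functions and Young's equality -/

namespace IsOrlicz

variable {Φ : ℝ → ℝ} (hΦ : IsOrlicz Φ)
include hΦ

theorem nonneg {s : ℝ} (hs : 0 ≤ s) : 0 ≤ Φ s := by
  rw [← hΦ.map_zero]
  exact hΦ.monotoneOn (Set.mem_Ici.2 le_rfl) hs hs

/-- Extending Φ by the constant Φ(0) keeps it convex because Φ is nondecreasing. It makes 0 an
interior point, so facts about right derivatives in the interior hold on all of [0, ∞). -/
theorem convexOn_comp_max : ConvexOn ℝ Set.univ fun s => Φ (max s 0) := by
  have himg : (fun s : ℝ => max s 0) '' Set.univ ⊆ Set.Ici 0 := by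
    rintro _ ⟨s, -, rfl⟩
    exact le_max_right s 0
  have hsub : ConvexOn ℝ ((fun s : ℝ => max s 0) '' Set.univ) Φ := by
    refine hΦ.convexOn.subset himg ?_
    have : (fun s : ℝ => max s 0) '' Set.univ = Set.Ici 0 :=
      himg.antisymm fun s hs => ⟨s, trivial, max_eq_left hs⟩
    rw [this]
    exact convex_Ici 0
  exact hsub.comp ((convexOn_id convex_univ).sup (convexOn_const 0 convex_univ))
    (hΦ.monotoneOn.mono himg)

omit hΦ in
theorem rightDeriv_comp_max {s : ℝ} (hs : 0 ≤ s) :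
    rightDeriv (fun s => Φ (max s 0)) s = rightDeriv Φ s := by
  refine derivWithin_congr (fun t ht => ?_) ?_
  · simp only [max_eq_left (hs.trans (Set.mem_Ioi.1 ht).le)]
  · simp only [max_eq_left hs]

theorem monotone_rightDeriv_comp_max : Monotone (rightDeriv fun s => Φ (max s 0)) := by
  have h := hΦ.convexOn_comp_max.monotoneOn_rightDeriv
  rw [interior_univ] at h
  exact monotoneOn_univ.1 h

theorem monotoneOn_rightDeriv : MonotoneOn (rightDeriv Φ) (Set.Ici 0) := fun s hs t ht hst => by
  rw [← rightDeriv_comp_max hs, ← rightDeriv_comp_max ht]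
  exact hΦ.monotone_rightDeriv_comp_max hst

theorem hasDerivWithinAt {s : ℝ} (hs : 0 ≤ s) :
    HasDerivWithinAt Φ (rightDeriv Φ s) (Set.Ioi s) s := by
  have h := hΦ.convexOn_comp_max.hasDerivWithinAt_rightDeriv_of_mem_interior (x := s) (by simp)
  change HasDerivWithinAt _ (rightDeriv _ s) _ _ at h
  rw [rightDeriv_comp_max hs] at h
  refine h.congr (fun t ht => ?_) ?_
  · rw [max_eq_left (hs.trans (Set.mem_Ioi.1 ht).le)]
  · rw [max_eq_left hs]

theorem rightDeriv_mul_le {s t : ℝ} (hs : 0 ≤ s) (hst : s < t) :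
    rightDeriv Φ s * (t - s) ≤ Φ t - Φ s := by
  have h := hΦ.convexOn.le_slope_of_hasDerivWithinAt_Ioi hs (hs.trans hst.le) hst
    (hΦ.hasDerivWithinAt hs)
  rwa [slope_def_field, le_div_iff₀ (sub_pos.2 hst)] at h

theorem rightDeriv_nonneg {s : ℝ} (hs : 0 ≤ s) : 0 ≤ rightDeriv Φ s := by
  rw [← rightDeriv_comp_max hs]
  -- The comparison point −1 lies where the extension is constant, so its right derivative there is
  -- 0.
  refine le_trans ?_ (hΦ.monotone_rightDeriv_comp_max (show -1 ≤ s by linarith))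
  have : rightDeriv (fun s => Φ (max s 0)) (-1) = 0 := by
    have h : (fun s => Φ (max s 0)) =ᶠ[𝓝[Set.Ioi (-1)] (-1)] fun _ => Φ 0 := by
      filter_upwards [mem_nhdsWithin_of_mem_nhds (Iio_mem_nhds (show (-1 : ℝ) < 0 by norm_num))]
        with t ht
      rw [max_eq_right (Set.mem_Iio.1 ht).le]
    rw [rightDeriv, h.derivWithin_eq (by simp)]
    simp
  rw [this]

theorem measurable_indicator_rightDeriv : Measurable ((Set.Ici 0).indicator (rightDeriv Φ)) := by
  have : (Set.Ici 0).indicator (rightDeriv Φ) =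
      (Set.Ici 0).indicator (rightDeriv fun s => Φ (max s 0)) :=
    Set.indicator_congr fun s hs => (rightDeriv_comp_max hs).symm
  rw [this]
  exact hΦ.monotone_rightDeriv_comp_max.measurable.indicator measurableSet_Ici

theorem measurable_indicator : Measurable ((Set.Ici 0).indicator Φ) := by
  have hc : Continuous fun s => Φ (max s 0) :=
    hΦ.continuousOn.comp_continuous (by fun_prop) fun s => le_max_right s 0
  have : (Set.Ici 0).indicator Φ = (Set.Ici 0).indicator fun s => Φ (max s 0) :=
    Set.indicator_congr fun s hs => by rw [max_eq_left hs]
  rw [this]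
  exact hc.measurable.indicator measurableSet_Ici

theorem intervalIntegrable_rightDeriv {u : ℝ} (hu : 0 ≤ u) :
    IntervalIntegrable (rightDeriv Φ) volume 0 u := by
  refine MonotoneOn.intervalIntegrable (hΦ.monotoneOn_rightDeriv.mono ?_)
  rw [Set.uIcc_of_le hu]
  exact fun s hs => hs.1

theorem integral_rightDeriv {u : ℝ} (hu : 0 ≤ u) : ∫ s in (0 : ℝ)..u, rightDeriv Φ s = Φ u := by
  rw [intervalIntegral.integral_eq_sub_of_hasDeriv_right_of_le hu
    (hΦ.continuousOn.mono fun s hs => hs.1) (fun s hs => hΦ.hasDerivWithinAt hs.1.le)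
    (hΦ.intervalIntegrable_rightDeriv hu), hΦ.map_zero, sub_zero]

theorem le_mul_rightDeriv {u : ℝ} (hu : 0 ≤ u) : Φ u ≤ u * rightDeriv Φ u := by
  rw [← hΦ.integral_rightDeriv hu]
  have h := intervalIntegral.integral_mono_on hu (hΦ.intervalIntegrable_rightDeriv hu)
    (_root_.intervalIntegrable_const (c := rightDeriv Φ u))
    fun s hs => hΦ.monotoneOn_rightDeriv hs.1 hu hs.2
  simpa using h

omit hΦ in
theorem ofReal_le_dilation_mul {t s : ℝ} (hs : 0 < s) (ht : dilation Φ t ≠ ⊤) :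
    ENNReal.ofReal (Φ (t * s)) ≤ dilation Φ t * ENNReal.ofReal (Φ s) := by
  rw [← ENNReal.div_le_iff_le_mul (Or.inr ht) (Or.inl ENNReal.ofReal_ne_top)]
  exact le_iSup₂ (f := fun s (_ : 0 < s) => ENNReal.ofReal (Φ (t * s)) / ENNReal.ofReal (Φ s)) s hs

/-- A finite upper index yields the `Δ₂`-condition. -/
theorem exists_dilation_bound {q : EReal} (hq : IsUpperIndex Φ q) (hqtop : q < ⊤) {c : ℝ}
    (hc : 0 ≤ c) : ∃ K : ℝ≥0∞, K ≠ ⊤ ∧ ∀ s, 0 ≤ s →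
      ENNReal.ofReal (Φ (c * s)) ≤ K * ENNReal.ofReal (Φ s) := by
  -- Any t > 1 whose logarithmic quotient is below ⊤ has M(t, Φ) < ∞. Taking t ≥ c as well,
  -- monotonicity of Φ lets M(t, Φ) serve as the constant for c.
  obtain ⟨t, ht, htc, ht1⟩ := ((hq.eventually_lt_const hqtop).and
    ((eventually_ge_atTop c).and (eventually_gt_atTop 1))).exists
  have hfin : dilation Φ t ≠ ⊤ := by
    intro h
    rw [h, ENNReal.log_top, EReal.top_div_of_pos_ne_top (by exact_mod_cast Real.log_pos ht1)
      (EReal.coe_ne_top _)] at ht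
    exact ht.ne rfl
  refine ⟨_, hfin, fun s hs => ?_⟩
  rcases hs.eq_or_lt with rfl | hs'
  · simp [hΦ.map_zero]
  refine le_trans (ENNReal.ofReal_le_ofReal ?_) (ofReal_le_dilation_mul hs' hfin)
  exact hΦ.monotoneOn (mul_nonneg hc hs) (mul_nonneg (hc.trans htc) hs)
    (mul_le_mul_of_nonneg_right htc hs)

/-- A lower index larger than `1` forces the right derivative to be unbounded. -/
theorem exists_lt_rightDeriv {p : EReal} (hp : IsLowerIndex Φ p) (h1p : 1 < p) (K : ℝ) :
    ∃ s, 0 ≤ s ∧ K < rightDeriv Φ s := by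
  by_contra! hK
  obtain ⟨r, hr1, hrp⟩ := EReal.lt_iff_exists_real_btwn.1 h1p
  have hr : 1 < r := by exact_mod_cast hr1
  have hK0 : 0 ≤ K := (hΦ.rightDeriv_nonneg le_rfl).trans (hK 0 le_rfl)
  -- As log t < 0 near 0, the inequality r < log M / log t turns into M(t, Φ) < t^r.
  have hM : ∀ᶠ t in 𝓝[>] (0 : ℝ), dilation Φ t ≤ ENNReal.ofReal (t ^ r) := by
    filter_upwards [hp.eventually_const_lt hrp, self_mem_nhdsWithin,
      mem_nhdsWithin_of_mem_nhds (Iio_mem_nhds one_pos)] with t ht ht0 ht1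
    have ht0 : 0 < t := ht0
    have hlog : Real.log t < 0 := Real.log_neg ht0 ht1
    have hne : dilation Φ t ≠ ⊤ := by
      intro h
      rw [h, ENNReal.log_top, EReal.top_div_of_neg_ne_bot (by exact_mod_cast hlog)
        (EReal.coe_ne_bot _)] at ht
      exact not_lt_bot ht
    rcases eq_or_ne (dilation Φ t) 0 with h0 | h0
    · rw [h0]; exact zero_le
    have hpos := ENNReal.toReal_pos h0 hne
    rw [← ENNReal.ofReal_toReal hne, ENNReal.log_ofReal_of_pos hpos, ← EReal.coe_div,
      EReal.coe_lt_coe_iff, lt_div_iff_of_neg hlog] at ht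
    rw [← ENNReal.ofReal_toReal hne]
    refine ENNReal.ofReal_le_ofReal ?_
    rw [Real.rpow_def_of_pos ht0, ← Real.log_le_iff_le_exp hpos, mul_comm]
    exact ht.le
  -- If φ ≤ K then Φ grows at most linearly, so Φ(u) ≤ M(t, Φ) Φ(u/t) ≤ t^r · K u/t = K u t^(r−1),
  -- which tends to 0 with t because r > 1. This contradicts Φ → ∞.
  have hle : ∀ u : ℝ, 0 < u → Φ u ≤ 0 := by
    intro u hu
    have hlim : Tendsto (fun t : ℝ => K * u * t ^ (r - 1)) (𝓝[>] 0) (𝓝 (K * u * 0)) := by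
      refine Tendsto.const_mul _ ?_
      have := (Real.continuousAt_rpow_const 0 (r - 1) (Or.inr (by linarith))).tendsto
      rw [Real.zero_rpow (by linarith)] at this
      exact this.mono_left nhdsWithin_le_nhds
    rw [mul_zero] at hlim
    refine ge_of_tendsto hlim ?_
    filter_upwards [hM, self_mem_nhdsWithin] with t ht ht0
    have ht0 : 0 < t := ht0
    have hut : 0 < u / t := div_pos hu ht0
    have h1 := ofReal_le_dilation_mul (Φ := Φ) hut (ne_top_of_le_ne_top ENNReal.ofReal_ne_top ht)
    rw [mul_div_cancel₀ _ ht0.ne'] at h1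
    have h2 : ENNReal.ofReal (Φ u) ≤ ENNReal.ofReal (t ^ r * Φ (u / t)) := by
      rw [ENNReal.ofReal_mul (by positivity)]
      exact h1.trans (mul_le_mul_left ht _)
    have h3 := (ENNReal.ofReal_le_ofReal_iff
      (mul_nonneg (by positivity) (hΦ.nonneg hut.le))).1 h2
    have h4 : Φ (u / t) ≤ u / t * K := (hΦ.le_mul_rightDeriv hut.le).trans
      (mul_le_mul_of_nonneg_left (hK _ hut.le) hut.le)
    calc Φ u ≤ t ^ r * Φ (u / t) := h3
      _ ≤ t ^ r * (u / t * K) := mul_le_mul_of_nonneg_left h4 (by positivity)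
      _ = K * u * t ^ (r - 1) := by
        rw [Real.rpow_sub_one ht0.ne']; ring
  obtain ⟨u, hu1, hu2⟩ := ((hΦ.tendsto_atTop.eventually_gt_atTop 0).and
    (eventually_gt_atTop 0)).exists
  exact absurd (hle u hu2) (not_le.2 hu1)

/-! ### The complementary function and Young's equality -/

section Complementary

variable (hunb : ∀ K, ∃ s, 0 ≤ s ∧ K < rightDeriv Φ s)
include hunb

/-- Without boundedness the real supremum defining ψ would take the default value 0. -/
theorem bddAbove_sublevel (t : ℝ) : BddAbove {s : ℝ | 0 ≤ s ∧ rightDeriv Φ s ≤ t} := by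
  obtain ⟨s₀, h0, hs₀⟩ := hunb t
  refine ⟨s₀, fun s hs => le_of_not_gt fun hlt => ?_⟩
  exact absurd (hΦ.monotoneOn_rightDeriv h0 hs.1 hlt.le) (not_le.2 (hs.2.trans_lt hs₀))

omit hΦ hunb in
theorem rightInv_nonneg (t : ℝ) : 0 ≤ rightInv Φ t := Real.sSup_nonneg fun _ hs => hs.1

theorem monotone_rightInv : Monotone (rightInv Φ) := by
  intro t t' htt
  rcases Set.eq_empty_or_nonempty {s : ℝ | 0 ≤ s ∧ rightDeriv Φ s ≤ t} with h | h
  · rw [rightInv, h, Real.sSup_empty]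
    exact rightInv_nonneg t'
  · exact csSup_le_csSup (hΦ.bddAbove_sublevel hunb t') h fun s hs => ⟨hs.1, hs.2.trans htt⟩

theorem continuous_complementary : Continuous (complementary Φ) :=
  intervalIntegral.continuous_primitive
    (fun _ _ => (hΦ.monotone_rightInv hunb).intervalIntegrable) 0

theorem monotoneOn_complementary : MonotoneOn (complementary Φ) (Set.Ici 0) := by
  intro v hv w _ hvw
  exact intervalIntegral.integral_mono_interval le_rfl hv hvw
    (ae_of_all _ fun t => rightInv_nonneg t) (hΦ.monotone_rightInv hunb).intervalIntegrable

/-- Young's equality. -/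
theorem mul_rightDeriv_eq {u : ℝ} (hu : 0 ≤ u) :
    u * rightDeriv Φ u = Φ u + complementary Φ (rightDeriv Φ u) := by
  set φ := rightDeriv fun s => Φ (max s 0) with hφ
  have hφmono : Monotone φ := hΦ.monotone_rightDeriv_comp_max
  have hφeq : ∀ s, 0 ≤ s → φ s = rightDeriv Φ s := fun s hs => rightDeriv_comp_max hs
  have hφ0 : ∀ s, 0 ≤ s → 0 ≤ φ s := fun s hs => by
    rw [hφeq s hs]; exact hΦ.rightDeriv_nonneg hs
  set b := rightDeriv Φ u with hb
  have hb0 : 0 ≤ b := hΦ.rightDeriv_nonneg hu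
  -- Tonelli for the region φ(s) ≤ t inside (0, u] × [0, b), with b = φ(u). The slice at t has
  -- length ψ(t) and the slice at s has length b − φ(s), so Φ*(b) = ub − Φ(u).
  set D : Set (ℝ × ℝ) := {x | φ x.1 ≤ x.2} with hD
  have hDm : MeasurableSet D :=
    measurableSet_le (hφmono.measurable.comp measurable_fst) measurable_snd
  have hswap := lintegral_lintegral_swap (μ := volume.restrict (Set.Ico 0 b))
    (ν := volume.restrict (Set.Ioc 0 u)) (f := fun t s => D.indicator 1 (s, t))
    ((measurable_one.indicator hDm).comp measurable_swap).aemeasurable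
  have hleft : ∀ t ∈ Set.Ico 0 b, ∫⁻ s in Set.Ioc 0 u, D.indicator 1 (s, t) =
      ENNReal.ofReal (rightInv Φ t) := by
    intro t ht
    have h1 : ∫⁻ s in Set.Ioc 0 u, D.indicator (1 : ℝ × ℝ → ℝ≥0∞) (s, t) =
        volume ({s | φ s ≤ t} ∩ Set.Ioc 0 u) := by
      have hm : MeasurableSet {s | φ s ≤ t} := measurableSet_le hφmono.measurable measurable_const
      rw [← Measure.restrict_apply hm, ← lintegral_indicator_one hm]
      rfl
    rw [h1]
    have hbd := hΦ.bddAbove_sublevel hunb t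
    apply le_antisymm
    · rw [← sub_zero (rightInv Φ t), ← Real.volume_Ioc]
      exact measure_mono fun s hs =>
        ⟨hs.2.1, le_csSup hbd ⟨hs.2.1.le, (hφeq s hs.2.1.le) ▸ hs.1⟩⟩
    · rw [← sub_zero (rightInv Φ t), ← Real.volume_Ioo]
      refine measure_mono fun s hs => ?_
      have hne : {s : ℝ | 0 ≤ s ∧ rightDeriv Φ s ≤ t}.Nonempty := by
        by_contra h
        have hs2 := hs.2
        rw [rightInv, Set.not_nonempty_iff_eq_empty.1 h, Real.sSup_empty] at hs2
        exact absurd hs.1 (not_lt.2 hs2.le)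
      obtain ⟨s', hs', hlt⟩ := exists_lt_of_lt_csSup hne hs.2
      have hst : φ s ≤ t := (hφmono hlt.le).trans ((hφeq s' hs'.1).symm ▸ hs'.2)
      -- If s > u then φ(s) ≥ b > t, a contradiction. This is why the t-interval excludes its
      -- endpoint b.
      refine ⟨hst, hs.1, le_of_not_gt fun hus => ?_⟩
      have := hφmono hus.le
      rw [hφeq u hu] at this
      linarith [ht.2]
  have hright : ∀ s ∈ Set.Ioc 0 u, ∫⁻ t in Set.Ico 0 b, D.indicator 1 (s, t) =
      ENNReal.ofReal (b - rightDeriv Φ s) := by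
    intro s hs
    have hm : MeasurableSet {t | φ s ≤ t} := measurableSet_Ici
    have h1 : ∫⁻ t in Set.Ico 0 b, D.indicator (1 : ℝ × ℝ → ℝ≥0∞) (s, t) =
        volume ({t | φ s ≤ t} ∩ Set.Ico 0 b) := by
      rw [← Measure.restrict_apply hm, ← lintegral_indicator_one hm]
      rfl
    have h2 : {t | φ s ≤ t} ∩ Set.Ico 0 b = Set.Ico (φ s) b := by
      ext t
      exact ⟨fun h => ⟨h.1, h.2.2⟩, fun h => ⟨h.1, (hφ0 s hs.1.le).trans h.1, h.2⟩⟩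
    rw [h1, h2, Real.volume_Ico, hφeq s hs.1.le]
  rw [setLIntegral_congr_fun measurableSet_Ico hleft,
    setLIntegral_congr_fun measurableSet_Ioc hright] at hswap
  have hint : IntegrableOn (rightInv Φ) (Set.Ico 0 b) :=
    ((hΦ.monotone_rightInv hunb).intervalIntegrable (a := 0) (b := b)).1.congr_set_ae
      Ico_ae_eq_Ioc
  have hint2 : IntegrableOn (fun s => b - rightDeriv Φ s) (Set.Ioc 0 u) :=
    ((_root_.intervalIntegrable_const (c := b)).sub (hΦ.intervalIntegrable_rightDeriv hu)).1
  have hnn : 0 ≤ᵐ[volume.restrict (Set.Ioc 0 u)] fun s => b - rightDeriv Φ s :=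
    (ae_restrict_iff' measurableSet_Ioc).2 (ae_of_all _ fun s hs =>
      sub_nonneg.2 (hΦ.monotoneOn_rightDeriv hs.1.le hu hs.2))
  rw [← ofReal_integral_eq_lintegral_ofReal hint (ae_of_all _ fun t => rightInv_nonneg t),
    ← ofReal_integral_eq_lintegral_ofReal hint2 hnn,
    ENNReal.ofReal_eq_ofReal_iff (integral_nonneg fun t => rightInv_nonneg t)
      (integral_nonneg_of_ae hnn), integral_Ico_eq_integral_Ioc,
    ← intervalIntegral.integral_of_le hb0, ← intervalIntegral.integral_of_le hu,
    intervalIntegral.integral_sub _root_.intervalIntegrable_const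
      (hΦ.intervalIntegrable_rightDeriv hu), hΦ.integral_rightDeriv hu] at hswap
  rw [complementary, hswap]
  simp

/-- The slope inequality between u and 2u gives uφ(u) ≤ Φ(2u) − Φ(u), so Young's equality yields
Φ*(φ(u)) ≤ Φ(2u) − 2Φ(u). -/
theorem complementary_rightDeriv_le {u : ℝ} (hu : 0 ≤ u) :
    complementary Φ (rightDeriv Φ u) ≤ Φ (2 * u) := by
  rcases hu.eq_or_lt with rfl | hu'
  · have h := hΦ.mul_rightDeriv_eq hunb le_rfl
    rw [zero_mul, hΦ.map_zero, zero_add] at h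
    simp [← h, hΦ.map_zero]
  · have h1 := hΦ.mul_rightDeriv_eq hunb hu
    have h2 := hΦ.rightDeriv_mul_le hu (show u < 2 * u by linarith)
    have h3 := hΦ.nonneg hu
    nlinarith

end Complementary

end IsOrlicz

/-! ### Products, sums and compositions in a calculus -/

namespace Calculus

variable {α : Type*} [MeasurableSpace α] {ι : Type*} [CommRing ι] [Algebra ℝ ι]
  (S : Calculus H α ι) {f g : α → ℝ} (hf : Measurable f) (hg : Measurable g)

theorem measurableSet_abs_le_inter {f g : α → ℝ} (hf : Measurable f) (hg : Measurable g) (n : ℕ) :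
    MeasurableSet ({a | |f a| ≤ n} ∩ {a | |g a| ≤ n}) :=
  (measurableSet_abs_le hf n).inter (measurableSet_abs_le hg n)

theorem monotone_abs_le_inter {α : Type*} (f g : α → ℝ) :
    Monotone fun n : ℕ => {a | |f a| ≤ n} ∩ {a | |g a| ≤ n} :=
  (monotone_abs_le f).inter (monotone_abs_le g)

theorem iUnion_abs_le_inter {α : Type*} (f g : α → ℝ) :
    ⋃ n : ℕ, {a | |f a| ≤ n} ∩ {a | |g a| ≤ n} = Set.univ :=
  Set.eq_univ_of_forall fun a => by
    obtain ⟨n, hn⟩ := exists_nat_ge (max |f a| |g a|)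
    exact Set.mem_iUnion.2 ⟨n, (le_max_left _ _).trans hn, (le_max_right _ _).trans hn⟩

/-- Where |f| and |g| are both at most n everything is bounded, so the corresponding spectral ranges
lie in the natural domain of the composition; by `closure_eq_pmap` they suffice to determine its
closure. -/
theorem strongMul_pmap :
    strongMul (S.pmap f hf) (S.pmap g hg) = S.pmap (f * g) (hf.mul hg) := by
  refine closure_eq_pmap (hf.mul hg) ?_ (measurableSet_abs_le_inter hf hg)
    (monotone_abs_le_inter f g) (iUnion_abs_le_inter f g) ?_
  · have key : ∀ η : (S.pmap g hg).domain, S.pmap g hg η ∈ (S.pmap f hf).domain →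
        MemLp (f * g) 2 (S.meas (η : H)) := fun η hη => (S.memLp_vec_iff hf hg η.2).1 hη
    refine ⟨?_, ?_⟩
    · rintro _ ⟨η, hη, rfl⟩
      exact key η hη
    · rintro ⟨_, η, hη, rfl⟩ ⟨ξ, hξ⟩ h
      obtain rfl : (η : H) = ξ := h
      exact S.vec_vec hf hg η.2 (key η hη)
  · intro n ξ
    set B := {a | |f a| ≤ n} ∩ {a | |g a| ≤ n}
    have hB : MeasurableSet B := measurableSet_abs_le_inter hf hg n
    have h1 : MemLp g 2 (S.meas (S.vec (ind B) ξ)) := (memLp_vec_ind_iff hB hg).2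
      (memLp_indicator_of_bounded hg hB (C := n) (fun _ h => h.2) _)
    have h2 : MemLp (f * g) 2 (S.meas (S.vec (ind B) ξ)) := (memLp_vec_ind_iff hB (hf.mul hg)).2
      (memLp_indicator_of_bounded (hf.mul hg) hB (C := n * n) (fun a h => by
        rw [Pi.mul_apply, abs_mul]
        exact mul_le_mul h.1 h.2 (abs_nonneg _) (Nat.cast_nonneg _)) _)
    exact ⟨⟨_, h1⟩, (S.memLp_vec_iff hf hg h1).2 h2, rfl⟩

theorem strongAdd_pmap :
    strongAdd (S.pmap f hf) (S.pmap g hg) = S.pmap (f + g) (hf.add hg) := by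
  refine closure_eq_pmap (hf.add hg) ?_ (measurableSet_abs_le_inter hf hg)
    (monotone_abs_le_inter f g) (iUnion_abs_le_inter f g) ?_
  · refine ⟨fun ξ hξ => ?_, ?_⟩
    · exact MemLp.add (f := f) (g := g) hξ.1 hξ.2
    · rintro ⟨ξ, hξ⟩ ⟨η, hη⟩ h
      obtain rfl : ξ = η := h
      exact (S.vec_add_fun hξ.1 hξ.2).symm
  · intro n ξ
    set B := {a | |f a| ≤ n} ∩ {a | |g a| ≤ n}
    have hB : MeasurableSet B := measurableSet_abs_le_inter hf hg n
    exact ⟨(memLp_vec_ind_iff hB hf).2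
        (memLp_indicator_of_bounded hf hB (C := n) (fun _ h => h.1) _),
      (memLp_vec_ind_iff hB hg).2
        (memLp_indicator_of_bounded hg hB (C := n) (fun _ h => h.2) _)⟩

theorem isPositiveSelfAdjoint_pmap (h0 : ∀ a, 0 ≤ f a) : IsPositiveSelfAdjoint (S.pmap f hf) := by
  refine ⟨S.dense_pmap_domain hf, S.isSelfAdjoint_pmap hf, fun ξ => ?_⟩
  rw [pmap_apply, S.inner_self_vec ξ.2]
  simpa using integral_nonneg h0

/-- The image measure integrates `k` to the operator of `k ∘ f`. -/
theorem isIntegral_spectral {k : ℝ → ℝ} (hk : Measurable k) :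
    (S.spectral f hf).IsIntegral k (S.pmap (k ∘ f) (hk.comp hf)) := by
  refine ⟨fun ξ => ?_, fun ξ => ?_⟩
  · rw [mem_pmap_domain, memLp_two_iff_lintegral (hk.comp hf), S.scalar_spectral hf,
      lintegral_map (by fun_prop) hf]
    rfl
  · rw [pmap_apply, S.inner_self_vec ξ.2, S.scalar_spectral hf,
      integral_map hf.aemeasurable hk.aestronglyMeasurable]
    rfl

/-- The image of the spectral measure under f represents f(S), and uniqueness identifies it. The
rule k(f(S)) = (k ∘ f)(S) follows from this and `integral_spectral`. -/
theorem spectralMeasure_pmap (h0 : ∀ a, 0 ≤ f a) :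
    spectralMeasure (S.pmap f hf) = S.spectral f hf :=
  (S.isIntegral_spectral hf measurable_id).spectralMeasure_eq
    (S.isPositiveSelfAdjoint_pmap hf h0).2.2

theorem integral_spectral {k : ℝ → ℝ} (hk : Measurable k) :
    (S.spectral f hf).integral k = S.pmap (k ∘ f) (hk.comp hf) := by
  rw [SpectralMeasure.integral_eq_pmap hk]
  exact ((S.isIntegral_spectral hf hk).eq_pmap hk).symm

end Calculus

/-! ### Affiliated operators -/

namespace SpectralMeasure

variable (E : SpectralMeasure H)

theorem spectral_proj {f : ℝ → ℝ} (hf : Measurable f) {B : Set ℝ} (hB : MeasurableSet B) :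
    (E.calculus.spectral f hf).proj B = E.proj (f ⁻¹' B) := by
  ext ξ
  rw [Calculus.spectral_proj_apply hf hB, E.vec_ind_eq_proj (hf hB)]

/-- The spectral measure `u* E u`. -/
def conj (u : H →L[ℂ] H) (hu : u ∈ unitary (H →L[ℂ] H)) : SpectralMeasure H where
  proj B := star u * E.proj B * u
  isStarProjection B hB := by
    have h := E.isStarProjection B hB
    have hu' : u * star u = 1 := hu.2
    refine ⟨?_, ?_⟩
    · have h1 := h.isIdempotentElem.eq
      calc star u * E.proj B * u * (star u * E.proj B * u)
          = star u * E.proj B * (u * star u) * E.proj B * u := by simp only [mul_assoc]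
        _ = star u * (E.proj B * E.proj B) * u := by rw [hu', mul_one, mul_assoc (star u)]
        _ = star u * E.proj B * u := by rw [h1]
    · exact h.isSelfAdjoint.conjugate' u
  of_not_measurable B hB := by rw [E.of_not_measurable B hB, mul_zero, zero_mul]
  univ := by rw [E.univ, mul_one]; exact hu.1
  inter B C hB hC := by
    have hu' : u * star u = 1 := hu.2
    rw [E.inter B C hB hC]
    calc star u * (E.proj B * E.proj C) * u
        = star u * E.proj B * 1 * E.proj C * u := by simp only [mul_one, mul_assoc]
      _ = _ := by rw [← hu']; simp only [mul_assoc]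
  hasSum B hB hd ξ := (E.hasSum B hB hd (u ξ)).mapL (star u)

theorem norm_unitary_apply {u : H →L[ℂ] H} (hu : u ∈ unitary (H →L[ℂ] H)) (ξ : H) :
    ‖u ξ‖ = ‖ξ‖ := by
  have h1 : inner ℂ (u ξ) (u ξ) = inner ℂ ξ ξ := by
    rw [← ContinuousLinearMap.adjoint_inner_right, ← ContinuousLinearMap.star_eq_adjoint]
    exact congrArg (fun T : H →L[ℂ] H => inner ℂ ξ (T ξ)) hu.1
  rw [norm_eq_sqrt_re_inner (𝕜 := ℂ), h1, ← norm_eq_sqrt_re_inner]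

theorem scalar_conj {u : H →L[ℂ] H} (hu : u ∈ unitary (H →L[ℂ] H)) (ξ : H) :
    (E.conj u hu).scalar ξ = E.scalar (u ξ) := by
  ext B hB
  rw [scalar_apply _ _ hB, scalar_apply _ _ hB,
    ← norm_unitary_apply (Unitary.star_mem hu) (E.proj B (u ξ))]
  rfl

variable {E}

/-- The spectral projections of an operator commute with the unitaries commuting with it. -/
theorem commute_proj_of_isAffiliated {M : VonNeumannAlgebra H} {A : H →ₗ.[ℂ] H}
    (hA : IsAffiliated M A) (hpos : ∀ ξ : A.domain, 0 ≤ RCLike.re (inner ℂ (ξ : H) (A ξ)))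
    (hE : E.IsIntegral (fun s => s) A) {u : H →L[ℂ] H} (hu : u ∈ M.commutant)
    (huu : u ∈ unitary (H →L[ℂ] H)) (B : Set ℝ) : Commute (E.proj B) u := by
  have hdom : ∀ ξ, ξ ∈ A.domain ↔ u ξ ∈ A.domain := by
    intro ξ
    refine ⟨fun h => (hA u hu huu ⟨ξ, h⟩).1, fun h => ?_⟩
    obtain ⟨h', -⟩ := hA (star u) (star_mem hu) (Unitary.star_mem huu) ⟨u ξ, h⟩
    have : star u (u ξ) = ξ := congrArg (fun T : H →L[ℂ] H => T ξ) huu.1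
    rwa [this] at h'
  -- Since u preserves A, the conjugate u*Eu also represents A; uniqueness gives u*Eu = E.
  have hc : (E.conj u huu).IsIntegral (fun s => s) A := by
    refine ⟨fun ξ => ?_, fun ξ => ?_⟩
    · rw [scalar_conj, ← hE.1, hdom]
    · obtain ⟨h, h'⟩ := hA u hu huu ξ
      rw [scalar_conj, ← hE.2 ⟨u ξ, h⟩, h', ← ContinuousLinearMap.adjoint_inner_right,
        ← ContinuousLinearMap.star_eq_adjoint]
      exact (congrArg (fun T : H →L[ℂ] H => inner ℂ (ξ : H) (T (A ξ))) huu.1).symm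
  have h := congrArg (fun F : SpectralMeasure H => u * F.proj B) (hc.unique hE hpos)
  have h2 : u * (star u * E.proj B * u) = E.proj B * u := by
    rw [← mul_assoc, ← mul_assoc, huu.2, one_mul]
  change u * (star u * E.proj B * u) = u * E.proj B at h
  rw [h2] at h
  exact h

/-- Every element of the commutant, a C*-algebra, is a linear combination of four unitaries of it,
so the double commutant theorem needs to be checked on unitaries only. -/
theorem mem_of_commute_unitary {M : VonNeumannAlgebra H} {T : H →L[ℂ] H}
    (hT : ∀ u ∈ M.commutant, u ∈ unitary (H →L[ℂ] H) → Commute T u) : T ∈ M := by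
  rw [← M.commutant_commutant, VonNeumannAlgebra.mem_commutant_iff]
  intro a ha
  have hcl : IsClosed (M.commutant.toStarSubalgebra : Set (H →L[ℂ] H)) := by
    rw [VonNeumannAlgebra.coe_toStarSubalgebra, VonNeumannAlgebra.coe_commutant]
    exact Set.isClosed_centralizer _
  obtain ⟨u, c, hu, -⟩ := CStarAlgebra.exists_sum_four_unitary
    (⟨a, ha⟩ : M.commutant.toStarSubalgebra)
  have hu' : a = ∑ i, c i • ((u i : M.commutant.toStarSubalgebra) : H →L[ℂ] H) := by
    have := congrArg (Subtype.val : M.commutant.toStarSubalgebra → H →L[ℂ] H) hu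
    simpa using this
  rw [hu', Finset.sum_mul, Finset.mul_sum]
  refine Finset.sum_congr rfl fun i _ => ?_
  have hi : ((u i : M.commutant.toStarSubalgebra) : H →L[ℂ] H) ∈ unitary (H →L[ℂ] H) := by
    have := (u i).2
    exact ⟨congrArg Subtype.val this.1, congrArg Subtype.val this.2⟩
  rw [smul_mul_assoc, mul_smul_comm, (hT _ (u i : M.commutant.toStarSubalgebra).2 hi).eq]

theorem commute_simpleOp {u : H →L[ℂ] H} (hu : ∀ B, Commute (E.proj B) u) (f : SimpleFunc ℝ ℝ) :
    Commute (E.simpleOp f) u := by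
  induction f using SimpleFunc.induction with
  | const c hB =>
    rw [simpleOp_simpleInd]
    exact (hu _).smul_left c
  | add _ h1 h2 => rw [map_add]; exact h1.add_left h2

/-- A unitary commuting with E preserves the scalar measures, hence the domain, and commutes with
simple functions, hence with their extension by `vec_map`. -/
theorem isAffiliated_pmap {M : VonNeumannAlgebra H} (hE : ∀ B, E.proj B ∈ M) {f : ℝ → ℝ}
    (hf : Measurable f) : IsAffiliated M (E.calculus.pmap f hf) := by
  intro u hu huu ξ
  have hc : ∀ B, Commute (E.proj B) u := fun B =>
    VonNeumannAlgebra.mem_commutant_iff.1 hu _ (hE B)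
  have hs : E.calculus.meas (u ξ) = E.calculus.meas (ξ : H) := by
    rw [calculus_meas, calculus_meas]
    ext B hB
    have h1 : E.proj B (u ξ) = u (E.proj B ξ) :=
      congrArg (fun T : H →L[ℂ] H => T ξ) (hc B).eq
    rw [scalar_apply _ _ hB, scalar_apply _ _ hB, h1, norm_unitary_apply huu]
  have hξ : MemLp f 2 (E.calculus.meas (ξ : H)) := ξ.2
  have huξ : MemLp f 2 (E.calculus.meas (u ξ)) := hs ▸ hξ
  refine ⟨huξ, ?_⟩
  exact E.calculus.vec_map hf u (fun i η => congrArg (fun T : H →L[ℂ] H => T η)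
    (commute_simpleOp hc i).eq) hξ huξ

theorem commute_proj (B C : Set ℝ) : Commute (E.proj B) (E.proj C) := by
  by_cases hB : MeasurableSet B
  · by_cases hC : MeasurableSet C
    · rw [commute_iff_eq, ← E.inter B C hB hC, ← E.inter C B hC hB, Set.inter_comm]
    · rw [E.of_not_measurable C hC]; exact Commute.zero_right _
  · rw [E.of_not_measurable B hB]; exact Commute.zero_left _

/-! ### Traces of spectral projections -/

section Trace

variable {M : VonNeumannAlgebra H} {τ : (H →L[ℂ] H) → ℝ≥0∞}
  (hτ : IsFaithfulNormalSemifiniteTrace M τ) (hE : ∀ B, E.proj B ∈ M)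
include hτ hE

theorem trace_union {B C : Set ℝ} (hB : MeasurableSet B) (hC : MeasurableSet C)
    (hd : Disjoint B C) : τ (E.proj (B ∪ C)) = τ (E.proj B) + τ (E.proj C) := by
  rw [E.proj_union hB hC hd]
  exact hτ.map_add _ (hE B) _ (hE C) (E.isStarProjection B hB).nonneg
    (E.isStarProjection C hC).nonneg

theorem trace_mono {B C : Set ℝ} (hB : MeasurableSet B) (hC : MeasurableSet C) (h : B ⊆ C) :
    τ (E.proj B) ≤ τ (E.proj C) := by
  rw [← Set.union_sdiff_cancel h, trace_union hτ hE hB (hC.diff hB) Set.disjoint_sdiff_right]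
  exact le_self_add

omit hτ hE in
theorem proj_mono {B C : Set ℝ} (hB : MeasurableSet B) (hC : MeasurableSet C) (h : B ⊆ C) :
    E.proj B ≤ E.proj C := by
  rw [← Set.union_sdiff_cancel h, E.proj_union hB (hC.diff hB) Set.disjoint_sdiff_right]
  exact le_add_of_nonneg_right (E.isStarProjection _ (hC.diff hB)).nonneg

omit hτ hE in
-- The order is tested on quadratic forms, where the claim is continuity from below of the scalar
-- measures. It supplies the supremum to which normality of the trace applies.
theorem isLUB_proj {B : ℕ → Set ℝ} (hB : ∀ n, MeasurableSet (B n)) (hmono : Monotone B) :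
    IsLUB (Set.range fun n => E.proj (B n)) (E.proj (⋃ n, B n)) := by
  have hU : MeasurableSet (⋃ n, B n) := .iUnion hB
  refine ⟨?_, fun b hb => ?_⟩
  · rintro _ ⟨n, rfl⟩
    exact proj_mono (hB n) hU (Set.subset_iUnion B n)
  · have hn : ∀ n, (b - E.proj (B n)).IsPositive := fun n =>
      (ContinuousLinearMap.le_def _ _).1 (hb ⟨n, rfl⟩)
    rw [ContinuousLinearMap.le_def]
    have hbs : IsSelfAdjoint b := by
      have := (hn 0).isSelfAdjoint.add (E.isStarProjection _ (hB 0)).isSelfAdjoint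
      rwa [sub_add_cancel] at this
    rw [ContinuousLinearMap.isPositive_def']
    refine ⟨hbs.sub (E.isStarProjection _ hU).isSelfAdjoint, fun ξ => ?_⟩
    have hre : ∀ C, MeasurableSet C → (b - E.proj C).reApplyInnerSelf ξ =
        b.reApplyInnerSelf ξ - (E.scalar ξ).real C := by
      intro C hC
      have h := congrArg (starRingEnd ℂ) (E.inner_proj_eq hC ξ)
      rw [inner_conj_symm, Complex.conj_ofReal] at h
      simp only [ContinuousLinearMap.reApplyInnerSelf_apply, _root_.sub_apply, inner_sub_left, h,
        map_sub]
      simp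
    rw [hre _ hU]
    have hlim : Tendsto (fun n => (E.scalar ξ).real (B n)) atTop
        (𝓝 ((E.scalar ξ).real (⋃ n, B n))) :=
      (ENNReal.tendsto_toReal (measure_ne_top _ _)).comp (tendsto_measure_iUnion_atTop hmono)
    refine sub_nonneg.2 (le_of_tendsto' hlim fun n => ?_)
    have := ((ContinuousLinearMap.isPositive_def'.1 (hn n))).2 ξ
    rw [hre _ (hB n)] at this
    linarith

/-- The distribution function of a measurable operator tends to `0`. -/
theorem exists_trace_Ioi_le {s₀ : ℝ} (hs₀ : 0 < s₀) (hfin : τ (E.proj (Set.Ioi s₀)) < ⊤) {t : ℝ}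
    (ht : 0 < t) : ∃ s, 0 < s ∧ τ (E.proj (Set.Ioi s)) ≤ ENNReal.ofReal t := by
  by_contra! h
  set B : ℕ → Set ℝ := fun n => Set.Ioc s₀ (s₀ + n) with hBdef
  have hB : ∀ n, MeasurableSet (B n) := fun n => measurableSet_Ioc
  have hmono : Monotone B := fun m n hmn =>
    Set.Ioc_subset_Ioc_right (by gcongr)
  have hU : ⋃ n, B n = Set.Ioi s₀ := by
    ext a
    simp only [hBdef, Set.mem_iUnion, Set.mem_Ioc, Set.mem_Ioi]
    refine ⟨fun ⟨_, h, _⟩ => h, fun h => ?_⟩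
    obtain ⟨n, hn⟩ := exists_nat_ge (a - s₀)
    exact ⟨n, h, by linarith⟩
  have hlub := isLUB_proj (E := E) hB hmono
  rw [hU] at hlub
  have hsup := hτ.normal (Set.range fun n => E.proj (B n))
    (by rintro _ ⟨n, rfl⟩; exact ⟨hE _, (E.isStarProjection _ (hB n)).nonneg⟩)
    (Set.range_nonempty _)
    (directedOn_range.2 (Monotone.directed_le fun m n hmn =>
      proj_mono (hB m) (hB n) (hmono hmn))) _ (hE _) hlub
  rw [iSup_range] at hsup
  -- If every tail had trace above t, cutting at s₀ + n would leave room t below τ(E(s₀, ∞)) for all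
  -- n. Normality carries this to the limit, which contradicts finiteness.
  have hle : ∀ n, τ (E.proj (B n)) + ENNReal.ofReal t ≤ τ (E.proj (Set.Ioi s₀)) := by
    intro n
    have hsplit : Set.Ioi s₀ = B n ∪ Set.Ioi (s₀ + n) :=
      (Set.Ioc_union_Ioi_eq_Ioi (by simp)).symm
    rw [hsplit, trace_union hτ hE (hB n) measurableSet_Ioi
      (Set.disjoint_left.2 fun a ha ha' => absurd ha.2 (not_le.2 ha'))]
    exact add_le_add_right (h (s₀ + n) (by positivity)).le _
  have h2 : τ (E.proj (Set.Ioi s₀)) + ENNReal.ofReal t ≤ τ (E.proj (Set.Ioi s₀)) := by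
    conv_lhs => rw [hsup, ENNReal.iSup_add]
    exact iSup_le hle
  have h3 : ENNReal.ofReal t ≤ 0 :=
    (ENNReal.add_le_add_iff_left hfin.ne).1 (by simpa using h2)
  simp only [nonpos_iff_eq_zero, ENNReal.ofReal_eq_zero] at h3
  linarith

end Trace

end SpectralMeasure

/-! ### The operator `φ(x)` -/

/-- The right derivative of `Φ`, extended by `0` to the negative half-line. -/
def rightDerivExt (Φ : ℝ → ℝ) : ℝ → ℝ := (Set.Ici 0).indicator (rightDeriv Φ)

namespace IsOrlicz

variable {Φ : ℝ → ℝ} (hΦ : IsOrlicz Φ)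
include hΦ

theorem measurable_rightDerivExt : Measurable (rightDerivExt Φ) :=
  hΦ.measurable_indicator_rightDeriv

theorem rightDerivExt_nonneg (s : ℝ) : 0 ≤ rightDerivExt Φ s :=
  Set.indicator_nonneg (fun _ hs => hΦ.rightDeriv_nonneg hs) s

/-- Monotonicity of φ; this inclusion yields the comparison of the distribution of φ(x) at v with
that of x at s. -/
theorem preimage_rightDerivExt_subset {s v : ℝ} (hs : 0 ≤ s) (hv : rightDeriv Φ s ≤ v) :
    rightDerivExt Φ ⁻¹' Set.Ioi v ⊆ Set.Ioi s := by
  intro w (hw : v < rightDerivExt Φ w)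
  have hv0 : 0 ≤ v := (hΦ.rightDeriv_nonneg hs).trans hv
  by_cases hw0 : 0 ≤ w
  · rw [rightDerivExt, Set.indicator_of_mem (Set.mem_Ici.2 hw0)] at hw
    refine Set.mem_Ioi.2 (lt_of_not_ge fun hws => ?_)
    exact absurd (hΦ.monotoneOn_rightDeriv hw0 hs hws) (not_le.2 (hv.trans_lt hw))
  · rw [rightDerivExt, Set.indicator_of_notMem (by simpa using hw0)] at hw
    exact absurd hw (not_lt.2 hv0)

/-- Young's equality at each point of the half-line; at negative points every term vanishes, the
last one because Φ*(0) = 0. -/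
theorem id_mul_rightDerivExt (hunb : ∀ K, ∃ s, 0 ≤ s ∧ K < rightDeriv Φ s) :
    (fun s : ℝ => s) * rightDerivExt Φ = (Set.Ici 0).indicator Φ +
      (Set.Ici 0).indicator (complementary Φ) ∘ rightDerivExt Φ := by
  ext s
  simp only [Pi.mul_apply, Pi.add_apply, Function.comp_apply]
  rw [Set.indicator_of_mem (Set.mem_Ici.2 (hΦ.rightDerivExt_nonneg s))]
  by_cases hs : 0 ≤ s
  · rw [rightDerivExt, Set.indicator_of_mem (Set.mem_Ici.2 hs),
      Set.indicator_of_mem (Set.mem_Ici.2 hs)]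
    exact hΦ.mul_rightDeriv_eq hunb hs
  · rw [rightDerivExt, Set.indicator_of_notMem (by simpa using hs),
      Set.indicator_of_notMem (by simpa using hs)]
    simp [complementary]

end IsOrlicz

/-! ### Singular values -/

section SingularValue

variable {τ : (H →L[ℂ] H) → ℝ≥0∞} {A : H →ₗ.[ℂ] H}

theorem bddBelow_singularValue_set (t : ℝ) :
    BddBelow {s : ℝ | 0 < s ∧ distribution τ A s ≤ ENNReal.ofReal t} :=
  ⟨0, fun _ hs => hs.1.le⟩

theorem singularValue_nonneg (t : ℝ) : 0 ≤ singularValue τ A t :=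
  Real.sInf_nonneg fun _ hs => hs.1.le

theorem singularValue_le {t s : ℝ} (hs : 0 ≤ s)
    (h : ∀ v, s < v → distribution τ A v ≤ ENNReal.ofReal t) : singularValue τ A t ≤ s :=
  le_of_forall_gt_imp_ge_of_dense fun v hv =>
    csInf_le (bddBelow_singularValue_set t) ⟨hs.trans_lt hv, h v hv⟩

theorem distribution_le_of_singularValue_lt (hanti : Antitone (distribution τ A)) {t s : ℝ}
    (hne : ∃ s, 0 < s ∧ distribution τ A s ≤ ENNReal.ofReal t) (h : singularValue τ A t < s) :
    distribution τ A s ≤ ENNReal.ofReal t := by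
  obtain ⟨s', hs', hlt⟩ := exists_lt_of_csInf_lt hne h
  exact (hanti hlt.le).trans hs'.2

theorem antitoneOn_singularValue
    (hne : ∀ t, 0 < t → ∃ s, 0 < s ∧ distribution τ A s ≤ ENNReal.ofReal t) :
    AntitoneOn (singularValue τ A) (Set.Ioi 0) := fun t ht t' _ htt =>
  csInf_le_csInf (bddBelow_singularValue_set t') (hne t ht) fun _ hs =>
    ⟨hs.1, hs.2.trans (ENNReal.ofReal_le_ofReal htt)⟩

end SingularValue

/-- Composition of the singular value function with the right derivative. -/
theorem memOrlicz_complementary {Φ : ℝ → ℝ} (hΦ : IsOrlicz Φ)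
    (hunb : ∀ K, ∃ s, 0 ≤ s ∧ K < rightDeriv Φ s) {q : EReal} (hq : IsUpperIndex Φ q)
    (hqtop : q < ⊤) {τ : (H →L[ℂ] H) → ℝ≥0∞} {x y : H →ₗ.[ℂ] H}
    (hanti : Antitone (distribution τ x))
    (hne : ∀ t, 0 < t → ∃ s, 0 < s ∧ distribution τ x s ≤ ENNReal.ofReal t)
    (hxy : ∀ s v, 0 ≤ s → rightDeriv Φ s ≤ v → distribution τ y v ≤ distribution τ x s)
    (hx : MemOrlicz Φ (singularValue τ x)) :
    MemOrlicz (complementary Φ) (singularValue τ y) := by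
  have hney : ∀ t, 0 < t → ∃ s, 0 < s ∧ distribution τ y s ≤ ENNReal.ofReal t := by
    intro t ht
    obtain ⟨s, hs, hst⟩ := hne t ht
    have h0 := hΦ.rightDeriv_nonneg hs.le
    exact ⟨rightDeriv Φ s + 1, by linarith, (hxy s _ hs.le (by linarith)).trans hst⟩
  have hpt : ∀ t, 0 < t →
      complementary Φ (singularValue τ y t) ≤ Φ (2 * singularValue τ x t) := by
    intro t ht
    set a := singularValue τ x t with ha
    have ha0 : 0 ≤ a := singularValue_nonneg t
    -- Working at s strictly above a = μ_t(x) guarantees that the distribution of x at s is at most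
    -- t. The limit s ↓ a is then taken in Φ(2s), by continuity of Φ, and not in φ.
    have hle : ∀ s, a < s → complementary Φ (singularValue τ y t) ≤ Φ (2 * s) := by
      intro s hs
      have hs0 : 0 ≤ s := ha0.trans hs.le
      have h1 : singularValue τ y t ≤ rightDeriv Φ s :=
        singularValue_le (hΦ.rightDeriv_nonneg hs0) fun v hv =>
          (hxy s v hs0 hv.le).trans (distribution_le_of_singularValue_lt hanti (hne t ht) hs)
      exact (hΦ.monotoneOn_complementary hunb (singularValue_nonneg t)
        (hΦ.rightDeriv_nonneg hs0) h1).trans (hΦ.complementary_rightDeriv_le hunb hs0)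
    have hlim : Tendsto (fun s => Φ (2 * s)) (𝓝[>] a) (𝓝 (Φ (2 * a))) := by
      have hc := hΦ.continuousOn (2 * a) (Set.mem_Ici.2 (by linarith))
      refine hc.tendsto.comp (tendsto_nhdsWithin_iff.2 ⟨?_, ?_⟩)
      · exact ((continuous_const.mul continuous_id).tendsto a).mono_left nhdsWithin_le_nhds
      · filter_upwards [self_mem_nhdsWithin] with s hs
        have : a < s := hs
        exact Set.mem_Ici.2 (by linarith)
    refine ge_of_tendsto hlim ?_
    filter_upwards [self_mem_nhdsWithin] with s hs using hle s hs
  obtain ⟨-, c, hc, hfin⟩ := hx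
  -- The dilation factor 2c absorbs both the 2 in Φ(2μ_t(x)) and the constant c for which
  -- Φ(μ_t(x)/c) is integrable, so the constant 1 works for y.
  obtain ⟨K, hK, hKle⟩ := hΦ.exists_dilation_bound hq hqtop (c := 2 * c) (by positivity)
  refine ⟨aemeasurable_restrict_of_antitoneOn measurableSet_Ioi (antitoneOn_singularValue hney),
    1, one_pos, ?_⟩
  calc ∫⁻ t in Set.Ioi (0 : ℝ), ENNReal.ofReal (complementary Φ (|singularValue τ y t| / 1))
      ≤ ∫⁻ t in Set.Ioi (0 : ℝ), K * ENNReal.ofReal (Φ (|singularValue τ x t| / c)) := by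
        refine setLIntegral_mono' measurableSet_Ioi fun t ht => ?_
        rw [div_one, abs_of_nonneg (singularValue_nonneg t), abs_of_nonneg (singularValue_nonneg t)]
        refine (ENNReal.ofReal_le_ofReal (hpt t ht)).trans ?_
        have h := hKle (singularValue τ x t / c) (div_nonneg (singularValue_nonneg t) hc.le)
        have he : 2 * c * (singularValue τ x t / c) = 2 * singularValue τ x t := by field_simp
        rwa [he] at h
    _ = K * ∫⁻ t in Set.Ioi (0 : ℝ), ENNReal.ofReal (Φ (|singularValue τ x t| / c)) :=
        lintegral_const_mul' _ _ hK
    _ < ⊤ := ENNReal.mul_lt_top hK.lt_top hfin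

/-- The spectral projections of a positive operator affiliated with `M` lie in `M`. -/
theorem spectralProj_mem {M : VonNeumannAlgebra H} {A : H →ₗ.[ℂ] H}
    (hA : IsPositiveSelfAdjoint A) (haff : IsAffiliated M A) (B : Set ℝ) :
    (spectralMeasure A).proj B ∈ M :=
  SpectralMeasure.mem_of_commute_unitary fun _ hu huu =>
    SpectralMeasure.commute_proj_of_isAffiliated haff hA.2.2 (isIntegral_spectralMeasure hA) hu
      huu B

end

end OrliczYoung

/-! ### Proof of the main theorem -/

open OrliczYoung

theorem mainTheorem7 {H : Type*} [NormedAddCommGroup H] [InnerProductSpace ℂ H] [CompleteSpace H]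
    (M : VonNeumannAlgebra H) (τ : (H →L[ℂ] H) → ENNReal)
    (hτ : OrliczYoung.IsFaithfulNormalSemifiniteTrace M τ)
    (Φ : ℝ → ℝ) (hΦ : OrliczYoung.IsOrlicz Φ)
    (p q : EReal) (hp : OrliczYoung.IsLowerIndex Φ p) (hq : OrliczYoung.IsUpperIndex Φ q)
    (h1p : 1 < p) (hpq : p ≤ q) (hqtop : q < ⊤)
    (x : H →ₗ.[ℂ] H) (hx : OrliczYoung.MemOrliczPos Φ M τ x) :
    ∃ y : H →ₗ.[ℂ] H,
      y = OrliczYoung.posCalculus x (OrliczYoung.rightDeriv Φ) ∧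
      OrliczYoung.MemOrliczPos (OrliczYoung.complementary Φ) M τ y ∧
      (∀ B C : Set ℝ, Commute (OrliczYoung.spectralProj x B) (OrliczYoung.spectralProj y C)) ∧
      OrliczYoung.strongMul x y = OrliczYoung.strongMul y x ∧
      OrliczYoung.strongMul x y =
        OrliczYoung.strongAdd (OrliczYoung.posCalculus x Φ)
          (OrliczYoung.posCalculus y (OrliczYoung.complementary Φ)) := by
  obtain ⟨⟨hpos, haff, s₀, hs₀, hfin⟩, hmem⟩ := hx
  have hunb := hΦ.exists_lt_rightDeriv hp h1p
  have hM := spectralProj_mem hpos haff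
  set E := spectralMeasure x with hEdef
  -- With x written as a function of E, all operators in the statement belong to one calculus.
  have hxE : x = E.calculus.pmap (fun s => s) measurable_id :=
    (isIntegral_spectralMeasure hpos).eq_pmap measurable_id
  have hg := hΦ.measurable_rightDerivExt
  set y := E.calculus.pmap (rightDerivExt Φ) hg with hy
  have hyE : spectralMeasure y = E.calculus.spectral (rightDerivExt Φ) hg :=
    E.calculus.spectralMeasure_pmap hg hΦ.rightDerivExt_nonneg
  have hdist : ∀ v, distribution τ y v = τ (E.proj (rightDerivExt Φ ⁻¹' Set.Ioi v)) := by
    intro v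
    rw [distribution, spectralProj, hyE, E.spectral_proj hg measurableSet_Ioi]
  have hxy : ∀ s v, 0 ≤ s → rightDeriv Φ s ≤ v → distribution τ y v ≤ distribution τ x s := by
    intro s v hs hv
    rw [hdist]
    exact SpectralMeasure.trace_mono hτ hM (hg measurableSet_Ioi) measurableSet_Ioi
      (hΦ.preimage_rightDerivExt_subset hs hv)
  have hanti : Antitone (distribution τ x) := fun s t hst =>
    SpectralMeasure.trace_mono hτ hM measurableSet_Ioi measurableSet_Ioi (Set.Ioi_subset_Ioi hst)
  have hne : ∀ t, 0 < t → ∃ s, 0 < s ∧ distribution τ x s ≤ ENNReal.ofReal t := fun t ht =>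
    SpectralMeasure.exists_trace_Ioi_le hτ hM hs₀ hfin ht
  have hψ : Measurable ((Set.Ici 0).indicator (complementary Φ)) :=
    (hΦ.continuous_complementary hunb).measurable.indicator measurableSet_Ici
  refine ⟨y, ?_, ⟨⟨E.calculus.isPositiveSelfAdjoint_pmap hg hΦ.rightDerivExt_nonneg,
    SpectralMeasure.isAffiliated_pmap hM hg, rightDeriv Φ s₀ + 1, ?_, ?_⟩, ?_⟩, ?_, ?_, ?_⟩
  -- `rightDerivExt` is by definition the truncated function that `posCalculus` integrates.
  · exact (SpectralMeasure.integral_eq_pmap hg).symm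
  · linarith [hΦ.rightDeriv_nonneg hs₀.le]
  · exact (hxy s₀ _ hs₀.le (by linarith)).trans_lt hfin
  · exact memOrlicz_complementary hΦ hunb hq hqtop hanti hne hxy hmem
  · intro B C
    rw [spectralProj, spectralProj, hyE, ← hEdef]
    by_cases hC : MeasurableSet C
    · rw [E.spectral_proj hg hC]
      exact SpectralMeasure.commute_proj _ _
    · rw [SpectralMeasure.of_not_measurable _ C hC]
      exact Commute.zero_right _
  · rw [hxE, hy, Calculus.strongMul_pmap, Calculus.strongMul_pmap]
    simp only [mul_comm]
  · have h1 : posCalculus x Φ = E.calculus.pmap _ hΦ.measurable_indicator :=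
      SpectralMeasure.integral_eq_pmap hΦ.measurable_indicator
    have h2 : posCalculus y (complementary Φ) = E.calculus.pmap _ (hψ.comp hg) := by
      rw [posCalculus, hyE]
      exact E.calculus.integral_spectral hg hψ
    rw [h1, h2, Calculus.strongAdd_pmap]
    conv_lhs => rw [hxE, hy, Calculus.strongMul_pmap]
    simp only [hΦ.id_mul_rightDerivExt hunb]
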